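/- All points and planes are in $\mathbb{R}^3$, and the $z$-direction is vertical. A finite point set $P$ is in general position if no four of its points lie in a plane, no three in a vertical plane, and no two in a horizontal plane. A halving plane of $P$ is a plane that passes through exactly three points of $P$ and divides the remaining points as equally as possible, i.e. the numbers of points of $P$ in its two open half-spaces differ by at most one. Let $h_3(n)$ be the maximum number of halving planes of an $n$-point set in general position. A finite set $H$ of planes is in general position if no plane of $H$ is vertical, every three distinct planes of $H$ meet in a unique point, and no point lies on more than three planes of $H$. The arrangement $\mathcal{A}(H)$ is the partition of $\mathbb{R}^3$ into relatively open convex cells (vertices, edges, faces and three-dimensional cells) induced by $H$. For $k\ge 1$, the $k$-level of $\mathcal{A}(H)$ is the closure of the set of points that lie on a unique plane of $H$ and have exactly $k-1$ planes of $H$ below them. Let $\ell(n)$ be the maximum, over all disjoint sets $R$, $B$ of planes such that $R\cup B$ is in general position and $|R\cup B|=n$, and over all $k,k'$, of the complexity of the intersection of the $k$-level of $\mathcal{A}(R)$ with the $k'$-level of $\mathcal{A}(B)$, that is, of the number of vertices, edges and faces of $\mathcal{A}(R\cup B)$ contained in this intersection. Then, for every $n$, both maxima exist, and $\ell(n)=\Theta(h_3(n))$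 as $n\to\infty$. -/

import Mathlib

open Filter Asymptotics

noncomputable section

namespace PlaneLevels

/-- Euclidean three-space, with coordinates `x 0`, `x 1`, `x 2`. -/
abbrev E3 : Type := EuclideanSpace ℝ (Fin 3)

/-- The vertical unit vector `(0, 0, 1)`. -/
def e3 : E3 := EuclideanSpace.single 2 1

/-- The affine plane with normal vector `v` and offset `a` (a plane when `v ≠ 0`). -/
def plane (v : E3) (a : ℝ) : Set E3 := {x | inner ℝ x v = a}

/-- The open half-space on the positive side of `plane v a`. -/
def posSide (v : E3) (a : ℝ) : Set E3 := {x | a < inner ℝ x v}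

/-- The open half-space on the negative side of `plane v a`. -/
def negSide (v : E3) (a : ℝ) : Set E3 := {x | inner ℝ x v < a}

/-- `H` is an affine plane in three-space. -/
def IsPlane (H : Set E3) : Prop := ∃ v : E3, v ≠ 0 ∧ ∃ a : ℝ, H = plane v a

/-- `H` contains a vertical line (for a plane: `H` is vertical). -/
def IsVertical (H : Set E3) : Prop := ∃ x : E3, ∀ t : ℝ, x + t • e3 ∈ H

/-- `H` is a horizontal plane. -/
def IsHorizontal (H : Set E3) : Prop := ∃ c : ℝ, H = {x | x 2 = c}

/-! ### Halving planes of point sets -/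

/-- General position of a point set: no four points in a plane, no three in a vertical plane,
no two in a horizontal plane. -/
structure PointsInGeneralPosition (P : Set E3) : Prop where
  not_four : ∀ H, IsPlane H → (P ∩ H).encard ≤ 3
  not_three : ∀ H, IsPlane H → IsVertical H → (P ∩ H).encard ≤ 2
  not_two : ∀ H, IsHorizontal H → (P ∩ H).encard ≤ 1

/-- `H` is a halving plane of `P`: a plane through exactly three points of `P` such that the
numbers of points of `P` in its two open sides differ by at most one. -/
def IsHalvingPlane (P : Set E3) (H : Set E3) : Prop :=
  ∃ v : E3, v ≠ 0 ∧ ∃ a : ℝ, H = plane v a ∧ (P ∩ H).encard = 3 ∧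
    (P ∩ posSide v a).encard ≤ (P ∩ negSide v a).encard + 1 ∧
    (P ∩ negSide v a).encard ≤ (P ∩ posSide v a).encard + 1

/-- All numbers of halving planes of `n`-point sets in general position. -/
def halvingCounts (n : ℕ) : Set ℕ :=
  {m | ∃ P : Set E3, P.Finite ∧ P.ncard = n ∧ PointsInGeneralPosition P ∧
    m = {H | IsHalvingPlane P H}.ncard}

/-- `h₃ n`: the maximum number of halving planes of an `n`-point set in general position. -/
def h₃ (n : ℕ) : ℕ := sSup (halvingCounts n)

/-! ### Arrangements of planes, levels and complexity -/

/-- General position of a set of planes: no plane is vertical, any three of the planes meet in a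
unique point, and no point is on more than three of the planes. -/
structure PlanesInGeneralPosition (A : Set (Set E3)) : Prop where
  isPlane : ∀ H ∈ A, IsPlane H
  not_vertical : ∀ H ∈ A, ¬ IsVertical H
  triple : ∀ H₁ ∈ A, ∀ H₂ ∈ A, ∀ H₃ ∈ A, H₁ ≠ H₂ → H₁ ≠ H₃ → H₂ ≠ H₃ →
    ∃! x : E3, x ∈ H₁ ∧ x ∈ H₂ ∧ x ∈ H₃
  not_four : ∀ x : E3, {H | H ∈ A ∧ x ∈ H}.encard ≤ 3

/-- The plane `H` passes strictly below the point `x`. -/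
def PassesBelow (H : Set E3) (x : E3) : Prop := ∃ t : ℝ, 0 < t ∧ x - t • e3 ∈ H

/-- `x` and `y` have the same position (on, above, below) with respect to every plane of `A`.
For a non-vertical plane, a point that is neither on it nor above it is below it. -/
def SameCell (A : Set (Set E3)) (x y : E3) : Prop :=
  ∀ H ∈ A, (x ∈ H ↔ y ∈ H) ∧ (PassesBelow H x ↔ PassesBelow H y)

/-- The (relatively open) cells, of all dimensions, of the arrangement of `A`. -/
def cells (A : Set (Set E3)) : Set (Set E3) :=
  {C | ∃ x : E3, C = {y | SameCell A x y}}

/-- The dimension of (the affine hull of) a cell. -/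
def cellDim (C : Set E3) : ℕ := Module.finrank ℝ (vectorSpan ℝ C)

/-- The `k`-level of the arrangement of `A`: the closure of the set of points that lie on a unique
plane of `A` and have exactly `k - 1` planes of `A` below them (so it is empty for `k = 0`). -/
def level (A : Set (Set E3)) (k : ℕ) : Set E3 :=
  closure {x | (∃! H, H ∈ A ∧ x ∈ H) ∧ {H | H ∈ A ∧ PassesBelow H x}.encard + 1 = k}

/-- The number of vertices, edges and faces (cells of dimension 0, 1, 2) of the arrangement of `A`
that are contained in `X`. -/
def complexity (A : Set (Set E3)) (X : Set E3) : ℕ :=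
  {C | C ∈ cells A ∧ cellDim C ≤ 2 ∧ C ⊆ X}.ncard

/-- All complexities of an intersection of a level in the arrangement of `R` and a level in the
arrangement of `B`, for disjoint `R`, `B` with `R ∪ B` a set of `n` planes in general position. -/
def intersectionComplexities (n : ℕ) : Set ℕ :=
  {m | ∃ R B : Set (Set E3), Disjoint R B ∧ (R ∪ B).Finite ∧ (R ∪ B).ncard = n ∧
    PlanesInGeneralPosition (R ∪ B) ∧
    ∃ k k' : ℕ, m = complexity (R ∪ B) (level R k ∩ level B k')}

/-- `ℓ n`: the maximum complexity of such an intersection. -/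
def ℓ (n : ℕ) : ℕ := sSup (intersectionComplexities n)

end PlaneLevels

end

open scoped Classical Topology

noncomputable section

namespace PlaneLevels

/-! Both functions are compared with `maxVertices N`, the largest number of vertices having the same
number `m` of planes below them in an arrangement of at most `N` planes. Since `ev t q` measures the
vertical distance both from the plane `t` to the point `q` and from the point `t` to the plane dual
to `q`, such vertices are dually the planes through three points with `m` points below.

Halving planes are the vertices with `m` about half of the remaining points. Conversely, planes
added far below or far above finitely many vertices bring any `m` to the middle, so `maxVertices (n
/ 2) ≤ h₃ n ≤ 2 * maxVertices n`.

A common point of a red and a blue level lies on a plane of each colour, so the intersection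
consists of vertices and edges only. Its vertices have one of two depths and its edges end at such
vertices, whence `ℓ n ≤ 14 * maxVertices n`. Conversely, add a slightly moved generic copy of `T` as
the second colour: each vertex `abc` reappears on `a`, `b` and the copy of `c`, in one of six pairs
of levels. Hence `maxVertices (n / 2) ≤ 6 * ℓ n`.

It remains to see that doubling the number of planes costs a constant factor. By
`Generic.exists_bisected` there are a dual plane `l` and three large subsets of `T`, each bisected
by `l`, such that any other dual plane is entirely above or entirely below `l` over one of them. So
each vertex other than `l` survives, at a known depth, in one of six arrangements from which a
twentieth of the planes has been removed (`Generic.ncard_vertices_le_step`). Forty rounds halve the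
number of planes. -/

/-! ### Coordinates, duality and generic position. -/

/-- The signed vertical distance from the plane `z = t₀ x + t₁ y + t₂` to the point `q`; equally,
the signed vertical distance from the point `t` to the plane `z = q₂ - q₀ x - q₁ y`. -/
def ev (t q : E3) : ℝ := q 2 - t 0 * q 0 - t 1 * q 1 - t 2

/-- The rate of change of `ev t` in the direction `d`. -/
def rate (t d : E3) : ℝ := d 2 - t 0 * d 0 - t 1 * d 1

/-- Twice the signed area of the triangle spanned by the horizontal projections. -/
def cross (a b c : E3) : ℝ := (b 0 - a 0) * (c 1 - a 1) - (b 1 - a 1) * (c 0 - a 0)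

/-- General position of the points, and of the dual planes, with coordinate vectors in `T`. -/
structure Generic (T : Finset E3) : Prop where
  pair : ∀ a ∈ T, ∀ b ∈ T, a ≠ b → a 0 ≠ b 0 ∨ a 1 ≠ b 1
  triple : ∀ a ∈ T, ∀ b ∈ T, ∀ c ∈ T, a ≠ b → a ≠ c → b ≠ c → cross a b c ≠ 0
  four : ∀ q, (T.filter (fun t => ev t q = 0)).card ≤ 3

/-- The points on three of the planes in `T` and above exactly `m` of them. -/
def vertices (T : Finset E3) (m : ℕ) : Set E3 :=
  {q | (T.filter (fun t => ev t q = 0)).card = 3 ∧ (T.filter (fun t => 0 < ev t q)).card = m}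

lemma e3_ext {p q : E3} (h0 : p 0 = q 0) (h1 : p 1 = q 1) (h2 : p 2 = q 2) : p = q := by
  ext i
  fin_cases i <;> assumption

lemma ev_add_smul (t q d : E3) (s : ℝ) : ev t (q + s • d) = ev t q + s * rate t d := by
  simp only [ev, rate, PiLp.add_apply, PiLp.smul_apply, smul_eq_mul]
  ring

lemma continuous_ev : Continuous fun p : E3 × E3 => ev p.1 p.2 := by
  unfold ev
  fun_prop

lemma continuous_ev_right (t : E3) : Continuous fun q : E3 => ev t q :=
  continuous_ev.comp (by fun_prop : Continuous fun q : E3 => (t, q))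

lemma continuous_ev_left (q : E3) : Continuous fun t : E3 => ev t q :=
  continuous_ev.comp (by fun_prop : Continuous fun t : E3 => (t, q))

/-- Differences of the three equations form a linear system in the horizontal coordinates with
determinant `cross a b c`. -/
lemma eq_of_ev_eq_zero {a b c p q : E3} (h : cross a b c ≠ 0) (ha : ev a p = 0) (hb : ev b p = 0)
    (hc : ev c p = 0) (ha' : ev a q = 0) (hb' : ev b q = 0) (hc' : ev c q = 0) : p = q := by
  unfold ev at *
  unfold cross at h
  have h0 : p 0 = q 0 := by
    apply mul_left_cancel₀ h
    linear_combination (c 1 - b 1) * (ha - ha') + (a 1 - c 1) * (hb - hb') +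
      (b 1 - a 1) * (hc - hc')
  have h1 : p 1 = q 1 := by
    apply mul_left_cancel₀ h
    linear_combination (b 0 - c 0) * (ha - ha') + (c 0 - a 0) * (hb - hb') +
      (a 0 - b 0) * (hc - hc')
  refine e3_ext h0 h1 ?_
  rw [h0, h1] at ha
  linarith

lemma exists_ev_eq_zero {a b c : E3} (h : cross a b c ≠ 0) :
    ∃ q, ev a q = 0 ∧ ev b q = 0 ∧ ev c q = 0 := by
  -- Cramer's rule for that system.
  set x : ℝ := ((b 1 - a 1) * (c 2 - a 2) - (c 1 - a 1) * (b 2 - a 2)) / cross a b c with hx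
  set y : ℝ := ((c 0 - a 0) * (b 2 - a 2) - (b 0 - a 0) * (c 2 - a 2)) / cross a b c with hy
  have hx' : x * cross a b c = _ := div_mul_cancel₀ _ h
  have hy' : y * cross a b c = _ := div_mul_cancel₀ _ h
  refine ⟨!₂[x, y, a 2 + a 0 * x + a 1 * y], ?_, ?_, ?_⟩ <;> simp [ev]
  · ring
  · apply mul_left_cancel₀ h
    unfold cross at *
    linear_combination (a 0 - b 0) * hx' + (a 1 - b 1) * hy'
  · apply mul_left_cancel₀ h
    unfold cross at *
    linear_combination (a 0 - c 0) * hx' + (a 1 - c 1) * hy'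

/-- Used to slide along the plane `a` to points strictly below the plane `b`. -/
lemma exists_direction {a b : E3} (h : a 0 ≠ b 0 ∨ a 1 ≠ b 1) :
    ∃ d : E3, rate a d = 0 ∧ rate b d = -1 := by
  rcases h with h | h
  · have h' : b 0 - a 0 ≠ 0 := fun h0 => h (by linarith)
    refine ⟨!₂[1 / (b 0 - a 0), 0, a 0 / (b 0 - a 0)], ?_, ?_⟩ <;> simp [rate] <;> field_simp <;>
      ring
  · have h' : b 1 - a 1 ≠ 0 := fun h0 => h (by linarith)
    refine ⟨!₂[0, 1 / (b 1 - a 1), a 1 / (b 1 - a 1)], ?_, ?_⟩ <;> simp [rate] <;> field_simp <;>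
      ring

/-- The direction of the line in which two non-parallel planes meet is transversal to each third
plane. -/
lemma exists_common_direction (a b : E3) :
    ∃ d : E3, rate a d = 0 ∧ rate b d = 0 ∧ ∀ c, cross a b c ≠ 0 → rate c d ≠ 0 := by
  refine ⟨!₂[-(b 1 - a 1), b 0 - a 0, -(b 1 - a 1) * a 0 + (b 0 - a 0) * a 1], ?_, ?_, ?_⟩
  · simp [rate]; ring
  · simp [rate]; ring
  · intro c hc
    simp only [rate]
    simp
    intro h'
    apply hc
    unfold cross
    linarith

lemma Generic.subset {S T : Finset E3} (hT : Generic T) (h : S ⊆ T) : Generic S where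
  pair a ha b hb := hT.pair a (h ha) b (h hb)
  triple a ha b hb c hc := hT.triple a (h ha) b (h hb) c (h hc)
  four q := (Finset.card_le_card (Finset.filter_subset_filter _ h)).trans (hT.four q)

lemma Generic.eq_of_filter_eq {T : Finset E3} (hT : Generic T) {p q : E3}
    (hp : (T.filter (fun t => ev t p = 0)).card = 3)
    (h : T.filter (fun t => ev t p = 0) ⊆ T.filter (fun t => ev t q = 0)) : p = q := by
  obtain ⟨a, b, c, hab, hac, hbc, habc⟩ := Finset.card_eq_three.1 hp
  have key : ∀ t ∈ ({a, b, c} : Finset E3), t ∈ T ∧ ev t p = 0 ∧ ev t q = 0 := by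
    intro t ht
    rw [← habc] at ht
    have h1 := Finset.mem_filter.1 ht
    exact ⟨h1.1, h1.2, (Finset.mem_filter.1 (h ht)).2⟩
  obtain ⟨ha, ha1, ha2⟩ := key a (by simp)
  obtain ⟨hb, hb1, hb2⟩ := key b (by simp)
  obtain ⟨hc, hc1, hc2⟩ := key c (by simp)
  exact eq_of_ev_eq_zero (hT.triple a ha b hb c hc hab hac hbc) ha1 hb1 hc1 ha2 hb2 hc2

lemma Generic.injOn_zeros {T : Finset E3} (hT : Generic T) :
    Set.InjOn (fun q => T.filter (fun t => ev t q = 0))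
      {q | (T.filter (fun t => ev t q = 0)).card = 3} :=
  fun _ hp _ _ h => hT.eq_of_filter_eq hp (le_of_eq h)

lemma Generic.finite_vertices {T : Finset E3} (hT : Generic T) (m : ℕ) :
    (vertices T m).Finite :=
  Set.Finite.of_finite_image ((Finset.finite_toSet T.powerset).subset (by
    rintro _ ⟨q, _, rfl⟩
    exact Finset.mem_coe.2 (Finset.mem_powerset.2 (Finset.filter_subset _ _)))) (hT.injOn_zeros.mono fun _ hq => hq.1)

/-- A crude bound, which makes the supremum in `maxVertices` finite. -/
lemma Generic.ncard_vertices_le {T : Finset E3} (hT : Generic T) (m : ℕ) :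
    (vertices T m).ncard ≤ 2 ^ T.card := by
  rw [← Finset.card_powerset, ← Set.ncard_coe_finset]
  refine Set.ncard_le_ncard_of_injOn (fun q => T.filter (fun t => ev t q = 0)) ?_
    (hT.injOn_zeros.mono fun _ hq => hq.1) (Finset.finite_toSet _)
  intro q _
  exact Finset.mem_coe.2 (Finset.mem_powerset.2 (Finset.filter_subset _ _))

lemma generic_empty : Generic ∅ := ⟨by simp, by simp, by simp⟩

/-! ### Generic insertion -/

/-- On each line of direction `d` the function is affine with nonzero slope, so a zero is isolated
on that line. -/
lemma dense_setOf_ne_zero {g : E3 → ℝ} {d : E3} {k : ℝ} (hk : k ≠ 0)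
    (h : ∀ t s, g (t + s • d) = g t + s * k) : Dense {t | g t ≠ 0} := by
  intro t
  by_cases ht : g t = 0
  · have hlim : Tendsto (fun s : ℝ => t + s • d) (𝓝[≠] 0) (𝓝 t) := by
      have : Continuous fun s : ℝ => t + s • d := by fun_prop
      simpa using (this.tendsto 0).mono_left nhdsWithin_le_nhds
    refine mem_closure_of_tendsto hlim ?_
    filter_upwards [self_mem_nhdsWithin] with s hs
    simp [h, ht, hk]
    exact hs
  · exact subset_closure ht

/-- The signed volume of the tetrahedron `a b c t`, up to a constant factor. -/
def vol (a b c t : E3) : ℝ :=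
  cross a b c * (t 2 - a 2) - cross a b t * (c 2 - a 2) + cross a c t * (b 2 - a 2)

lemma vol_eq_zero {a b c t q : E3} (ha : ev a q = 0) (hb : ev b q = 0) (hc : ev c q = 0)
    (ht : ev t q = 0) : vol a b c t = 0 := by
  unfold vol cross ev at *
  linear_combination (-((b 0 - a 0) * (c 1 - a 1) - (b 1 - a 1) * (c 0 - a 0))) * (ht - ha) +
    ((b 0 - a 0) * (t 1 - a 1) - (b 1 - a 1) * (t 0 - a 0)) * (hc - ha) -
    ((c 0 - a 0) * (t 1 - a 1) - (c 1 - a 1) * (t 0 - a 0)) * (hb - ha)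

lemma dense_inter_finset {ι : Type*} (S : Finset ι) {f : ι → Set E3} {U : Set E3}
    (hU : IsOpen U) (hU' : Dense U) (hf : ∀ i ∈ S, IsOpen (f i)) (hd : ∀ i ∈ S, Dense (f i)) :
    Dense (U ∩ ⋂ i ∈ S, f i) := by
  refine Dense.inter_of_isOpen_left hU' ?_ hU
  exact dense_biInter_of_isOpen hf S.countable_toSet hd

lemma Generic.exists_insert {T : Finset E3} (hT : Generic T) {U : Set E3} (hU : IsOpen U)
    (hne : U.Nonempty) : ∃ t ∈ U, t ∉ T ∧ Generic (insert t T) := by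
  -- More than `pair` asks for, but a single open dense condition for each `a`.
  have h1 : ∀ a ∈ T, Dense {t : E3 | t 0 - a 0 ≠ 0} := fun a _ =>
    dense_setOf_ne_zero (d := !₂[1, 0, 0]) (k := 1) one_ne_zero (fun t s => by simp; ring)
  have h2 : ∀ p ∈ T.offDiag, Dense {t : E3 | cross p.1 p.2 t ≠ 0} := by
    rintro ⟨a, b⟩ hp
    rw [Finset.mem_offDiag] at hp
    rcases hT.pair a hp.1 b hp.2.1 hp.2.2 with h | h
    · exact dense_setOf_ne_zero (d := !₂[0, 1, 0]) (k := b 0 - a 0) (fun h0 => h (by linarith))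
        (fun t s => by simp [cross]; ring)
    · exact dense_setOf_ne_zero (d := !₂[1, 0, 0]) (k := a 1 - b 1) (fun h0 => h (by linarith))
        (fun t s => by simp [cross]; ring)
  -- The two equalities make the condition vacuous for repeated indices, so the index set can be a
  -- plain product.
  have h3 : ∀ p ∈ T.offDiag ×ˢ T,
      Dense {t : E3 | p.2 = p.1.1 ∨ p.2 = p.1.2 ∨ vol p.1.1 p.1.2 p.2 t ≠ 0} := by
    rintro ⟨⟨a, b⟩, c⟩ hp
    simp only [Finset.mem_product, Finset.mem_offDiag] at hp
    by_cases hca : c = a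
    · simp [hca]
    by_cases hcb : c = b
    · simp [hcb]
    simp only [hca, hcb, false_or]
    exact dense_setOf_ne_zero (d := !₂[0, 0, 1])
      (hT.triple a hp.1.1 b hp.1.2.1 c hp.2 hp.1.2.2 (Ne.symm hca) (Ne.symm hcb))
      (fun t s => by simp [vol, cross]; ring)
  have o1 : ∀ a ∈ T, IsOpen {t : E3 | t 0 - a 0 ≠ 0} := fun a _ =>
    isOpen_ne_fun (by fun_prop) continuous_const
  have o2 : ∀ p ∈ T.offDiag, IsOpen {t : E3 | cross p.1 p.2 t ≠ 0} := fun p _ =>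
    isOpen_ne_fun (by unfold cross; fun_prop) continuous_const
  have o3 : ∀ p ∈ T.offDiag ×ˢ T,
      IsOpen {t : E3 | p.2 = p.1.1 ∨ p.2 = p.1.2 ∨ vol p.1.1 p.1.2 p.2 t ≠ 0} := fun p _ =>
    IsOpen.union isOpen_const (IsOpen.union isOpen_const
      (isOpen_ne_fun (by unfold vol cross; fun_prop) continuous_const))
  have D1 := dense_inter_finset T isOpen_univ dense_univ o1 h1
  have D2 := dense_inter_finset T.offDiag
    (isOpen_univ.inter (isOpen_biInter_finset o1)) D1 o2 h2
  have D3 := dense_inter_finset (T.offDiag ×ˢ T)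
    ((isOpen_univ.inter (isOpen_biInter_finset o1)).inter (isOpen_biInter_finset o2)) D2 o3 h3
  obtain ⟨t, htU, ht⟩ := D3.exists_mem_open hU hne |>.imp fun _ h => h.symm
  simp only [Set.mem_inter_iff, Set.mem_univ, true_and, Set.mem_iInter] at ht
  obtain ⟨⟨g1, g2⟩, g3⟩ := ht
  have g1' : ∀ a ∈ T, t 0 ≠ a 0 := fun a ha h => g1 a ha (by linarith)
  have g2' : ∀ a ∈ T, ∀ b ∈ T, a ≠ b → cross a b t ≠ 0 := fun a ha b hb hab =>
    g2 (a, b) (Finset.mem_offDiag.2 ⟨ha, hb, hab⟩)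
  have g3' : ∀ a ∈ T, ∀ b ∈ T, ∀ c ∈ T, a ≠ b → a ≠ c → b ≠ c → vol a b c t ≠ 0 := by
    intro a ha b hb c hc hab hac hbc
    rcases g3 ((a, b), c) (by simp [ha, hb, hc, hab]) with h | h | h
    · exact absurd h.symm hac
    · exact absurd h.symm hbc
    · exact h
  have htT : t ∉ T := fun h => g1' t h rfl
  refine ⟨t, htU, htT, ?_, ?_, ?_⟩
  · intro a ha b hb hab
    rcases Finset.mem_insert.1 ha with rfl | ha' <;> rcases Finset.mem_insert.1 hb with rfl | hb'
    · exact absurd rfl hab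
    · exact Or.inl (g1' b hb')
    · exact Or.inl (g1' a ha').symm
    · exact hT.pair a ha' b hb' hab
  · intro a ha b hb c hc hab hac hbc
    rcases Finset.mem_insert.1 ha with rfl | ha' <;> rcases Finset.mem_insert.1 hb with rfl | hb' <;>
      rcases Finset.mem_insert.1 hc with rfl | hc'
    any_goals first
      | exact absurd rfl hab
      | exact absurd rfl hac
      | exact absurd rfl hbc
    · have := g2' b hb' c hc' hbc
      unfold cross at *
      intro h
      apply this
      linarith
    · have := g2' a ha' c hc' hac
      unfold cross at *
      intro h
      apply this
      linarith
    · exact g2' a ha' b hb' hab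
    · exact hT.triple a ha' b hb' c hc' hab hac hbc
  · intro q
    rw [Finset.filter_insert]
    split_ifs with h
    · rw [Finset.card_insert_of_notMem (fun h' => htT (Finset.mem_filter.1 h').1)]
      by_contra hcon
      have h3 : (T.filter (fun t => ev t q = 0)).card = 3 :=
        le_antisymm (hT.four q) (by omega)
      obtain ⟨a, b, c, hab, hac, hbc, habc⟩ := Finset.card_eq_three.1 h3
      have key : ∀ t ∈ ({a, b, c} : Finset E3), t ∈ T ∧ ev t q = 0 := by
        intro t ht
        rw [← habc] at ht
        exact Finset.mem_filter.1 ht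
      obtain ⟨ha, ha1⟩ := key a (by simp)
      obtain ⟨hb, hb1⟩ := key b (by simp)
      obtain ⟨hc, hc1⟩ := key c (by simp)
      exact g3' a ha b hb c hc hab hac hbc (vol_eq_zero ha1 hb1 hc1 h)
    · exact hT.four q

/-- Any number of planes can be added far below (`σ = 1`) or far above (`σ = -1`) the points
of `Q`. -/
lemma Generic.exists_extension {T : Finset E3} (hT : Generic T) {Q : Set E3} (hQ : Q.Finite)
    (σ : ℝ) (hσ : σ ≠ 0) (N : ℕ) :
    ∃ X : Finset E3, Disjoint X T ∧ X.card = N ∧ Generic (T ∪ X) ∧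
      ∀ t ∈ X, ∀ q ∈ Q, 0 < σ * ev t q := by
  induction N with
  | zero => exact ⟨∅, by simp, by simp, by simpa using hT, by simp⟩
  | succ N ih =>
    obtain ⟨X, hX, hN, hG, hpos⟩ := ih
    have hopen : IsOpen {t : E3 | ∀ q ∈ Q, 0 < σ * ev t q} := by
      have : {t : E3 | ∀ q ∈ Q, 0 < σ * ev t q} = ⋂ q ∈ Q, {t | 0 < σ * ev t q} := by
        ext; simp
      rw [this]
      exact hQ.isOpen_biInter fun q _ =>
        isOpen_lt continuous_const (continuous_const.mul (continuous_ev_left q))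
    have hne : {t : E3 | ∀ q ∈ Q, 0 < σ * ev t q}.Nonempty := by
      obtain ⟨C, hC⟩ := (hQ.image fun q : E3 => |q 2|).bddAbove
      -- At this horizontal plane `σ * ev t q` equals `σ * q 2 + |σ| * C + 1`, which is at least `1`
      -- on `Q`.
      refine ⟨!₂[0, 0, -(|σ| * C + 1) / σ], fun q hq => ?_⟩
      have h1 : |q 2| ≤ C := hC ⟨q, hq, rfl⟩
      have h2 : |σ * q 2| ≤ |σ| * C := by
        rw [abs_mul]
        exact mul_le_mul_of_nonneg_left h1 (abs_nonneg σ)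
      have h3 : σ * ev !₂[0, 0, -(|σ| * C + 1) / σ] q = σ * q 2 + (|σ| * C + 1) := by
        simp [ev]
        field_simp
        ring
      rw [h3]
      linarith [neg_abs_le (σ * q 2)]
    obtain ⟨t, ht, htT, htG⟩ := hG.exists_insert hopen hne
    rw [Finset.mem_union, not_or] at htT
    refine ⟨insert t X, ?_, ?_, ?_, ?_⟩
    · rw [Finset.disjoint_insert_left]
      exact ⟨htT.1, hX⟩
    · rw [Finset.card_insert_of_notMem htT.2, hN]
    · rw [Finset.union_insert]
      exact htG
    · intro s hs
      rcases Finset.mem_insert.1 hs with rfl | hs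
      · exact ht
      · exact hpos s hs

lemma exists_generic (n : ℕ) : ∃ T : Finset E3, Generic T ∧ T.card = n := by
  obtain ⟨X, -, hX, hG, -⟩ := generic_empty.exists_extension Set.finite_empty 1 one_ne_zero n
  exact ⟨X, by simpa using hG, hX⟩

/-! ### Order statistics -/

/-- The least value with at least `k` elements at or below it has fewer than `k` strictly below it.
The two counts add up to more than `A.card`, which forces a lower set and an upper set taken at
different parameters to meet. -/
lemma exists_order_statistic {ι : Type*} (A : Finset ι) (g : ι → ℝ) {k : ℕ} (hk : 1 ≤ k)
    (hkA : k ≤ A.card) :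
    ∃ w, k ≤ (A.filter (fun t => g t ≤ w)).card ∧
      A.card + 1 ≤ (A.filter (fun t => w ≤ g t)).card + k := by
  have hA : A.Nonempty := Finset.card_pos.1 (by omega)
  obtain ⟨b, hb, hbmax⟩ := A.exists_max_image g hA
  have hne : (A.filter (fun t => k ≤ (A.filter (fun s => g s ≤ g t)).card)).Nonempty := by
    refine ⟨b, Finset.mem_filter.2 ⟨hb, ?_⟩⟩
    rwa [Finset.filter_true_of_mem hbmax]
  obtain ⟨a, ha, hamin⟩ := Finset.exists_min_image _ g hne
  rw [Finset.mem_filter] at ha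
  refine ⟨g a, ha.2, ?_⟩
  have hlt : (A.filter (fun t => g t < g a)).card < k := by
    by_contra! hcon
    obtain ⟨s, hs, hsmax⟩ := (A.filter (fun t => g t < g a)).exists_max_image g
      (Finset.card_pos.1 (by omega))
    rw [Finset.mem_filter] at hs
    have h1 : A.filter (fun t => g t < g a) ⊆ A.filter (fun t => g t ≤ g s) := by
      intro t ht
      exact Finset.mem_filter.2 ⟨(Finset.mem_filter.1 ht).1, hsmax t ht⟩
    have := hamin s (Finset.mem_filter.2 ⟨hs.1, hcon.trans (Finset.card_le_card h1)⟩)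
    linarith [hs.2]
  have := Finset.card_filter_add_card_filter_not (s := A) (fun t => g t < g a)
  simp only [not_lt] at this
  omega

/-- Medians over a finite set of an affine family of functions. -/
lemma exists_median {ι : Type*} {A : Finset ι} (hA : A.Nonempty) (x y z : ι → ℝ) :
    ∃ f : ℝ → ℝ → ℝ,
      (∀ u v, A.card ≤ 2 * (A.filter (fun t => z t + u * x t + v * y t ≤ f u v)).card ∧
        A.card ≤ 2 * (A.filter (fun t => f u v ≤ z t + u * x t + v * y t)).card) ∧
      ∀ u v u' v', ∃ t ∈ A, f u' v' - f u v ≤ (u' - u) * x t + (v' - v) * y t := by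
  have hpos := hA.card_pos
  choose f h1 h2 using fun u v : ℝ => exists_order_statistic A
    (fun t => z t + u * x t + v * y t) (k := (A.card + 1) / 2) (by omega) (by omega)
  refine ⟨f, fun u v => ⟨?_, ?_⟩, fun u v u' v' => ?_⟩
  · have := h1 u v
    omega
  · have := h2 u v
    omega
  · obtain ⟨t, ht⟩ := Finset.inter_nonempty_of_card_lt_card_add_card
      (Finset.filter_subset (fun t => z t + u * x t + v * y t ≤ f u v) A)
      (Finset.filter_subset (fun t => f u' v' ≤ z t + u' * x t + v' * y t) A)
      (by have := h1 u v; have := h2 u' v'; omega)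
    simp only [Finset.mem_inter, Finset.mem_filter] at ht
    exact ⟨t, ht.1.1, by linarith [ht.1.2, ht.2.2]⟩

lemma exists_lipschitz_of_median {ι : Type*} {A : Finset ι} {x y : ι → ℝ} {f : ℝ → ℝ → ℝ}
    (h : ∀ u v u' v', ∃ t ∈ A, f u' v' - f u v ≤ (u' - u) * x t + (v' - v) * y t) :
    ∃ C, 0 ≤ C ∧ ∀ u v u' v', |f u' v' - f u v| ≤ C * (|u' - u| + |v' - v|) := by
  refine ⟨∑ t ∈ A, (|x t| + |y t|), Finset.sum_nonneg fun _ _ => by positivity, ?_⟩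
  have key : ∀ u v u' v', f u' v' - f u v ≤
      (∑ t ∈ A, (|x t| + |y t|)) * (|u' - u| + |v' - v|) := by
    intro u v u' v'
    obtain ⟨t, ht, hle⟩ := h u v u' v'
    have h1 : |x t| + |y t| ≤ ∑ t ∈ A, (|x t| + |y t|) :=
      Finset.single_le_sum (f := fun t => |x t| + |y t|) (fun _ _ => by positivity) ht
    have h2 : (u' - u) * x t ≤ |u' - u| * |x t| := by
      rw [← abs_mul]; exact le_abs_self _
    have h3 : (v' - v) * y t ≤ |v' - v| * |y t| := by
      rw [← abs_mul]; exact le_abs_self _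
    calc f u' v' - f u v ≤ |u' - u| * |x t| + |v' - v| * |y t| := by linarith
      _ ≤ (|x t| + |y t|) * (|u' - u| + |v' - v|) := by
        have := mul_nonneg (abs_nonneg (u' - u)) (abs_nonneg (y t))
        have := mul_nonneg (abs_nonneg (v' - v)) (abs_nonneg (x t))
        linarith
      _ ≤ _ := mul_le_mul_of_nonneg_right h1 (by positivity)
  intro u v u' v'
  rw [abs_le]
  have := key u' v' u v
  rw [abs_sub_comm u u', abs_sub_comm v v'] at this
  exact ⟨by linarith, key u v u' v'⟩

/-- Growth at rate `c` forces both signs within distance `|F 0| / c` of the origin. -/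
lemma exists_eq_zero_of_expanding {F : ℝ → ℝ} (hF : Continuous F) {c : ℝ} (hc : 0 < c)
    (h : ∀ u u', u ≤ u' → c * (u' - u) ≤ F u' - F u) : ∃ u, F u = 0 := by
  refine mem_range_of_exists_le_of_exists_ge hF ⟨-(|F 0| / c), ?_⟩ ⟨|F 0| / c, ?_⟩
  · have h1 := h (-(|F 0| / c)) 0 (by simp; positivity)
    have h2 : c * (0 - -(|F 0| / c)) = |F 0| := by field_simp; ring
    linarith [le_abs_self (F 0)]
  · have h1 := h 0 (|F 0| / c) (by positivity)
    have h2 : c * (|F 0| / c - 0) = |F 0| := by field_simp; ring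
    linarith [neg_abs_le (F 0)]

lemma continuous_of_abs_sub_le {F : ℝ → ℝ} {C : ℝ} (h : ∀ u v, |F u - F v| ≤ C * |u - v|) :
    Continuous F := by
  refine (LipschitzWith.of_dist_le_mul (K := C.toNNReal) fun u v => ?_).continuous
  rw [Real.dist_eq, Real.dist_eq]
  exact (h u v).trans (mul_le_mul_of_nonneg_right (Real.le_coe_toNNReal C) (abs_nonneg _))

/-! ### Bisecting several sets simultaneously. -/

/-- The difference of the medians over two sets separated by a vertical strip is expanding. -/
lemma median_sub_expanding {ι : Type*} {A B : Finset ι} {x y : ι → ℝ} {x₁ x₂ : ℝ}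
    (hA : ∀ t ∈ A, x t ≤ x₁) (hB : ∀ t ∈ B, x₂ ≤ x t) {f g : ℝ → ℝ → ℝ}
    (hf : ∀ u v u' v', ∃ t ∈ A, f u' v' - f u v ≤ (u' - u) * x t + (v' - v) * y t)
    (hg : ∀ u v u' v', ∃ t ∈ B, g u' v' - g u v ≤ (u' - u) * x t + (v' - v) * y t)
    (v : ℝ) (u u' : ℝ) (huu' : u ≤ u') :
    (x₂ - x₁) * (u' - u) ≤ (g u' v - f u' v) - (g u v - f u v) := by
  -- As `u` grows, the median over `A` rises with slope at most `x₁` and the median over `B` with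
  -- slope at least `x₂`; the second bound uses `hg` with its parameters exchanged.
  obtain ⟨a, ha, h1⟩ := hf u v u' v
  obtain ⟨b, hb, h2⟩ := hg u' v u v
  have h3 := mul_le_mul_of_nonneg_left (hA a ha) (sub_nonneg.2 huu')
  have h4 := mul_le_mul_of_nonneg_left (hB b hb) (sub_nonneg.2 huu')
  linarith

/-- A line bisecting two sets that are separated by a vertical strip. -/
lemma exists_bisecting_line {ι : Type*} {A B : Finset ι} (hA₀ : A.Nonempty) (hB₀ : B.Nonempty)
    (x z : ι → ℝ) {x₁ x₂ : ℝ} (hx : x₁ < x₂) (hA : ∀ t ∈ A, x t ≤ x₁) (hB : ∀ t ∈ B, x₂ ≤ x t) :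
    ∃ u w, ∀ S : Finset ι, S = A ∨ S = B →
      S.card ≤ 2 * (S.filter (fun t => z t + u * x t ≤ w)).card ∧
      S.card ≤ 2 * (S.filter (fun t => w ≤ z t + u * x t)).card := by
  obtain ⟨f, hf, hf'⟩ := exists_median hA₀ x 0 z
  obtain ⟨g, hg, hg'⟩ := exists_median hB₀ x 0 z
  obtain ⟨C, hC, hfC⟩ := exists_lipschitz_of_median hf'
  obtain ⟨D, hD, hgD⟩ := exists_lipschitz_of_median hg'
  have hcont : Continuous fun u => g u 0 - f u 0 := by
    refine continuous_of_abs_sub_le (C := D + C) fun u u' => ?_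
    have h1 := hfC u' 0 u 0
    have h2 := hgD u' 0 u 0
    have h3 := abs_sub (g u 0 - g u' 0) (f u 0 - f u' 0)
    rw [show g u 0 - f u 0 - (g u' 0 - f u' 0) = g u 0 - g u' 0 - (f u 0 - f u' 0) by ring]
    simp only [sub_self, abs_zero, add_zero] at h1 h2
    linarith
  obtain ⟨u, hu⟩ := exists_eq_zero_of_expanding hcont (sub_pos.2 hx)
    (median_sub_expanding hA hB hf' hg' 0)
  have hfg : g u 0 = f u 0 := by linarith
  refine ⟨u, f u 0, ?_⟩
  rintro S (rfl | rfl)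
  · simpa using hf u 0
  · simpa [hfg] using hg u 0

/-- A plane bisecting three sets whose horizontal projections have no common line transversal. -/
lemma exists_bisecting_plane {ι : Type*} {A B D : Finset ι} (hA₀ : A.Nonempty) (hB₀ : B.Nonempty)
    (hD₀ : D.Nonempty) (x y z : ι → ℝ) {x₁ x₂ γ : ℝ} (hx : x₁ < x₂) (hγ : 0 < γ)
    (hA : ∀ t ∈ A, x t ≤ x₁) (hB : ∀ t ∈ B, x₂ ≤ x t) (hD : ∀ t ∈ D, x₁ ≤ x t ∧ x t ≤ x₂)
    (hAy : ∀ t ∈ A, y t ≤ 0) (hBy : ∀ t ∈ B, y t ≤ 0) (hDy : ∀ t ∈ D, γ ≤ y t) :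
    ∃ u v w, ∀ S : Finset ι, S = A ∨ S = B ∨ S = D →
      S.card ≤ 2 * (S.filter (fun t => z t + u * x t + v * y t ≤ w)).card ∧
      S.card ≤ 2 * (S.filter (fun t => w ≤ z t + u * x t + v * y t)).card := by
  obtain ⟨f, hf, hf'⟩ := exists_median hA₀ x y z
  obtain ⟨g, hg, hg'⟩ := exists_median hB₀ x y z
  obtain ⟨h, hh, hh'⟩ := exists_median hD₀ x y z
  obtain ⟨C₁, hC₁, hfC⟩ := exists_lipschitz_of_median hf'
  obtain ⟨C₂, hC₂, hgC⟩ := exists_lipschitz_of_median hg'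
  obtain ⟨C₃, hC₃, hhC⟩ := exists_lipschitz_of_median hh'
  have hx' := sub_pos.2 hx
  have hexp := median_sub_expanding hA hB hf' hg'
  -- For fixed `v`, some slope `u` makes the medians over `A` and `B` agree; the third set is then
  -- treated by varying `v` along this curve.
  have hU : ∀ v, ∃ u, g u v - f u v = 0 := by
    intro v
    have hcont : Continuous fun u => g u v - f u v := by
      refine continuous_of_abs_sub_le (C := C₂ + C₁) fun u u' => ?_
      have h1 := hfC u' v u v
      have h2 := hgC u' v u v
      have h3 := abs_sub (g u v - g u' v) (f u v - f u' v)
      rw [show g u v - f u v - (g u' v - f u' v) = g u v - g u' v - (f u v - f u' v) by ring]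
      simp only [sub_self, abs_zero, add_zero] at h1 h2
      linarith
    exact exists_eq_zero_of_expanding hcont hx' (hexp v)
  choose U hU using hU
  -- The expansion rate `x₂ - x₁` in `u` must compensate a change in `v` bounded by the Lipschitz
  -- constants.
  have hUlip : ∀ v v', |U v - U v'| ≤ (C₁ + C₂) / (x₂ - x₁) * |v - v'| := by
    have key : ∀ v v', U v' ≤ U v → (x₂ - x₁) * |U v - U v'| ≤ (C₁ + C₂) * |v - v'| := by
      intro v v' hle
      rw [abs_of_nonneg (sub_nonneg.2 hle)]
      have h0 := hexp v' (U v') (U v) hle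
      have h1 := hfC (U v) v (U v) v'
      have h2 := hgC (U v) v (U v) v'
      simp only [sub_self, abs_zero, zero_add] at h1 h2
      rw [abs_sub_comm v' v] at h1 h2
      have h3 := neg_abs_le (f (U v) v' - f (U v) v)
      have h4 := le_abs_self (g (U v) v' - g (U v) v)
      linarith [hU v, hU v']
    intro v v'
    rw [div_mul_eq_mul_div, le_div_iff₀ hx', mul_comm]
    rcases le_total (U v') (U v) with hle | hle
    · exact key v v' hle
    · rw [abs_sub_comm (U v), abs_sub_comm v]
      exact key v' v hle
  have hG : Continuous fun v => h (U v) v - f (U v) v := by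
    refine continuous_of_abs_sub_le
      (C := (C₃ + C₁) * ((C₁ + C₂) / (x₂ - x₁) + 1)) fun v v' => ?_
    have h1 := hfC (U v') v' (U v) v
    have h2 := hhC (U v') v' (U v) v
    have h3 := abs_sub (h (U v) v - h (U v') v') (f (U v) v - f (U v') v')
    have h4 := mul_le_mul_of_nonneg_left (hUlip v v') (add_nonneg hC₃ hC₁)
    rw [show h (U v) v - f (U v) v - (h (U v') v' - f (U v') v') =
      h (U v) v - h (U v') v' - (f (U v) v - f (U v') v') by ring]
    linarith
  obtain ⟨v, hv⟩ := exists_eq_zero_of_expanding hG hγ (by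
    intro v v' hle
    have hdv := sub_nonneg.2 hle
    obtain ⟨b, hb, hb'⟩ := hh' (U v') v' (U v) v
    have hb1 := mul_le_mul_of_nonneg_right (hDy b hb) hdv
    -- Along the curve the medians over `A` and `B` agree, so either may be compared with that over
    -- `D`. Taking `A` when `U` increases and `B` when it decreases makes the contribution of `x`
    -- nonnegative, while `y` contributes at least `γ * (v' - v)`.
    rcases le_total (U v) (U v') with hu | hu
    · obtain ⟨a, ha, ha'⟩ := hf' (U v) v (U v') v'
      have h1 := mul_nonneg (sub_nonneg.2 hu) (sub_nonneg.2 ((hA a ha).trans (hD b hb).1))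
      have h2 := mul_nonneg hdv (neg_nonneg.2 (hAy a ha))
      linarith
    · obtain ⟨a, ha, ha'⟩ := hg' (U v) v (U v') v'
      have h1 := mul_nonneg (sub_nonneg.2 hu) (sub_nonneg.2 ((hD b hb).2.trans (hB a ha)))
      have h2 := mul_nonneg hdv (neg_nonneg.2 (hBy a ha))
      linarith [hU v, hU v'])
  have hgf : g (U v) v = f (U v) v := by linarith [hU v]
  have hhf : h (U v) v = f (U v) v := by linarith
  refine ⟨U v, v, f (U v) v, ?_⟩
  rintro S (rfl | rfl | rfl)
  · exact hf (U v) v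
  · rw [← hgf]
    exact hg (U v) v
  · rw [← hhf]
    exact hh (U v) v

/-- An affine function that takes both weak signs on each of the three sets of
`exists_bisecting_plane` vanishes. -/
lemma exists_strict_sign {ι : Type*} {A B D : Finset ι} {x y : ι → ℝ} {x₁ x₂ : ℝ}
    (hx : x₁ < x₂) (hA : ∀ t ∈ A, x t ≤ x₁) (hB : ∀ t ∈ B, x₂ ≤ x t)
    (hD : ∀ t ∈ D, x₁ ≤ x t ∧ x t ≤ x₂) (hAy : ∀ t ∈ A, y t ≤ 0) (hBy : ∀ t ∈ B, y t ≤ 0)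
    (hDy : ∀ t ∈ D, 0 < y t) {u v w : ℝ} (h : u ≠ 0 ∨ v ≠ 0 ∨ w ≠ 0) :
    ∃ S : Finset ι, (S = A ∨ S = B ∨ S = D) ∧
      ((∀ t ∈ S, 0 < w + u * x t + v * y t) ∨ (∀ t ∈ S, w + u * x t + v * y t < 0)) := by
  by_contra! hcon
  -- By the intermediate value theorem, both weak signs on `S` give a zero in every convex set that
  -- contains the projections of `S`.
  have hzero : ∀ S : Finset ι, (S = A ∨ S = B ∨ S = D) → ∀ K : Set (ℝ × ℝ), Convex ℝ K →
      (∀ t ∈ S, (x t, y t) ∈ K) → ∃ p ∈ K, w + u * p.1 + v * p.2 = 0 := by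
    intro S hS K hK hSK
    obtain ⟨⟨a, ha, ha'⟩, ⟨b, hb, hb'⟩⟩ := hcon S hS
    have hpre := hK.isPreconnected
    have hc : ContinuousOn (fun p : ℝ × ℝ => w + u * p.1 + v * p.2) K := by fun_prop
    have := hpre.intermediate_value (hSK a ha) (hSK b hb) hc ⟨ha', hb'⟩
    simpa using this
  obtain ⟨p, ⟨hp1, hp2⟩, hp⟩ := hzero A (by simp) {p | p.1 ≤ x₁ ∧ p.2 ≤ 0}
    ((convex_halfSpace_le (f := Prod.fst) (IsLinearMap.mk (fun _ _ => rfl) fun _ _ => rfl) _).inter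
      (convex_halfSpace_le (f := Prod.snd) (IsLinearMap.mk (fun _ _ => rfl) fun _ _ => rfl) _))
    (fun t ht => ⟨hA t ht, hAy t ht⟩)
  obtain ⟨q, ⟨hq1, hq2⟩, hq⟩ := hzero B (by simp) {p | x₂ ≤ p.1 ∧ p.2 ≤ 0}
    ((convex_halfSpace_ge (f := Prod.fst) (IsLinearMap.mk (fun _ _ => rfl) fun _ _ => rfl) _).inter
      (convex_halfSpace_le (f := Prod.snd) (IsLinearMap.mk (fun _ _ => rfl) fun _ _ => rfl) _))
    (fun t ht => ⟨hB t ht, hBy t ht⟩)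
  obtain ⟨r, ⟨⟨hr1, hr2⟩, hr3⟩, hr⟩ := hzero D (by simp) {p | (x₁ ≤ p.1 ∧ p.1 ≤ x₂) ∧ 0 < p.2}
    (((convex_halfSpace_ge (f := Prod.fst)
        (IsLinearMap.mk (fun _ _ => rfl) fun _ _ => rfl) _).inter
      (convex_halfSpace_le (f := Prod.fst)
        (IsLinearMap.mk (fun _ _ => rfl) fun _ _ => rfl) _)).inter
      (convex_halfSpace_gt (f := Prod.snd) (IsLinearMap.mk (fun _ _ => rfl) fun _ _ => rfl) _))
    (fun t ht => ⟨hD t ht, hDy t ht⟩)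
  -- `r` is strictly above the segment from `p` to `q`
  have hpq : 0 < q.1 - p.1 := by linarith
  have hpos : 0 < (q.1 - p.1) * r.2 - (q.1 - r.1) * p.2 - (r.1 - p.1) * q.2 := by
    have h1 := mul_pos hpq hr3
    have h2 := mul_nonneg (sub_nonneg.2 (hr2.trans hq1)) (neg_nonneg.2 hp2)
    have h3 := mul_nonneg (sub_nonneg.2 (hp1.trans hr1)) (neg_nonneg.2 hq2)
    linarith
  have hv : v = 0 := by
    have : v * ((q.1 - p.1) * r.2 - (q.1 - r.1) * p.2 - (r.1 - p.1) * q.2) = 0 := by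
      linear_combination (q.1 - p.1) * hr - (q.1 - r.1) * hp - (r.1 - p.1) * hq
    exact (mul_eq_zero.1 this).resolve_right hpos.ne'
  have hu : u = 0 := by
    have : u * (q.1 - p.1) = 0 := by
      rw [hv] at hp hq
      linear_combination hq - hp
    exact (mul_eq_zero.1 this).resolve_right hpq.ne'
  rw [hu, hv] at hp
  rcases h with h | h | h
  · exact h hu
  · exact h hv
  · exact h (by linarith)

/-! ### Three large bisected sets without a common line transversal. -/

lemma Generic.card_line_le {T : Finset E3} (hT : Generic T) {a b c : ℝ} (h : a ≠ 0 ∨ b ≠ 0) :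
    (T.filter (fun t => a * t 0 + b * t 1 = c)).card ≤ 2 := by
  by_contra! hcon
  obtain ⟨p, q, r, hp, hq, hr, hpq, hpr, hqr⟩ := Finset.two_lt_card_iff.1 hcon
  rw [Finset.mem_filter] at hp hq hr
  refine hT.triple p hp.1 q hq.1 r hr.1 hpq hpr hqr ?_
  have h1 := hp.2
  have h2 := hq.2
  have h3 := hr.2
  unfold cross
  rcases h with h | h
  · apply mul_left_cancel₀ h
    linear_combination (r 1 - p 1) * (h2 - h1) - (q 1 - p 1) * (h3 - h1)
  · apply mul_left_cancel₀ h
    linear_combination (q 0 - p 0) * (h3 - h1) - (r 0 - p 0) * (h2 - h1)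

/-- Two vertical lines cut a generic set into three large parts. -/
lemma Generic.exists_strips {T : Finset E3} (hT : Generic T) (hN : 100 ≤ T.card) :
    ∃ x₁ x₂ : ℝ, x₁ < x₂ ∧ T.card ≤ 4 * (T.filter (fun t => t 0 < x₁)).card ∧
      T.card ≤ 4 * (T.filter (fun t => x₂ < t 0)).card ∧
      T.card ≤ 4 * (T.filter (fun t => x₁ < t 0 ∧ t 0 < x₂)).card := by
  -- Cut near the terciles. At most two points lie on each cutting line; this and rounding are
  -- absorbed in passing from a third to a quarter.
  obtain ⟨x₁, h1, h1'⟩ := exists_order_statistic T (fun t => t 0) (k := T.card / 3)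
    (by omega) (by omega)
  obtain ⟨x₂, h2, h2'⟩ := exists_order_statistic T (fun t => t 0) (k := 2 * (T.card / 3))
    (by omega) (by omega)
  have hline : ∀ c : ℝ, (T.filter (fun t => t 0 = c)).card ≤ 2 := fun c => by
    simpa using hT.card_line_le (a := 1) (b := 0) (c := c) (Or.inl one_ne_zero)
  have hle : ∀ c : ℝ, (T.filter (fun t => t 0 ≤ c)).card ≤
      (T.filter (fun t => t 0 < c)).card + 2 := fun c => by
    have : T.filter (fun t => t 0 ≤ c) =
        T.filter (fun t => t 0 < c) ∪ T.filter (fun t => t 0 = c) := by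
      ext t
      simp only [Finset.mem_filter, Finset.mem_union, le_iff_lt_or_eq]
      tauto
    rw [this]
    exact (Finset.card_union_le _ _).trans (Nat.add_le_add_left (hline c) _)
  have hge : ∀ c : ℝ, (T.filter (fun t => c ≤ t 0)).card ≤
      (T.filter (fun t => c < t 0)).card + 2 := fun c => by
    have : T.filter (fun t => c ≤ t 0) =
        T.filter (fun t => c < t 0) ∪ T.filter (fun t => t 0 = c) := by
      ext t
      simp only [Finset.mem_filter, Finset.mem_union, le_iff_lt_or_eq, eq_comm]
      tauto
    rw [this]
    exact (Finset.card_union_le _ _).trans (Nat.add_le_add_left (hline c) _)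
  have hcompl : ∀ c : ℝ, (T.filter (fun t => t 0 < c)).card +
      (T.filter (fun t => c ≤ t 0)).card = T.card := fun c => by
    simpa using Finset.card_filter_add_card_filter_not (s := T) (fun t => t 0 < c)
  have hmid : T.card ≤ (T.filter (fun t => t 0 ≤ x₁)).card +
      (T.filter (fun t => x₂ ≤ t 0)).card +
      (T.filter (fun t => x₁ < t 0 ∧ t 0 < x₂)).card := by
    have : T ⊆ (T.filter (fun t => t 0 ≤ x₁) ∪ T.filter (fun t => x₂ ≤ t 0)) ∪
        T.filter (fun t => x₁ < t 0 ∧ t 0 < x₂) := by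
      intro t ht
      simp only [Finset.mem_filter, Finset.mem_union, ht, true_and]
      by_cases h : t 0 ≤ x₁
      · exact Or.inl (Or.inl h)
      · by_cases h' : x₂ ≤ t 0
        · exact Or.inl (Or.inr h')
        · exact Or.inr ⟨not_le.1 h, not_le.1 h'⟩
    refine (Finset.card_le_card this).trans ((Finset.card_union_le _ _).trans ?_)
    exact Nat.add_le_add_right (Finset.card_union_le _ _) _
  have a1 := hle x₁
  have a2 := hge x₂
  have a5 := hle x₂
  have a3 := hcompl x₁
  have a4 := hcompl x₂
  have hM : T.card ≤ 4 * (T.filter (fun t => x₁ < t 0 ∧ t 0 < x₂)).card := by omega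
  refine ⟨x₁, x₂, ?_, by omega, by omega, hM⟩
  obtain ⟨t, ht⟩ := Finset.card_pos.1
    (show 0 < (T.filter (fun t => x₁ < t 0 ∧ t 0 < x₂)).card by omega)
  have := (Finset.mem_filter.1 ht).2
  exact this.1.trans this.2

/-- There are a plane `l` and three large sets, each bisected by `l`, such that every other plane
is, over one of the sets, entirely above or entirely below `l`. -/
lemma Generic.exists_bisected {T : Finset E3} (hT : Generic T) (hN : 100 ≤ T.card) :
    ∃ (l : E3) (A B D : Finset E3), (∀ S, S = A ∨ S = B ∨ S = D → S ⊆ T ∧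
        T.card ≤ 20 * (S.filter (fun t => 0 ≤ ev t l)).card ∧
        T.card ≤ 20 * (S.filter (fun t => ev t l ≤ 0)).card) ∧
      ∀ q, q ≠ l → ∃ S, (S = A ∨ S = B ∨ S = D) ∧
        ((∀ t ∈ S, ev t l < ev t q) ∨ (∀ t ∈ S, ev t q < ev t l)) := by
  obtain ⟨x₁, x₂, hx, hL, hR, hM⟩ := hT.exists_strips hN
  set L := T.filter (fun t => t 0 < x₁) with hLdef
  set R := T.filter (fun t => x₂ < t 0) with hRdef
  set M := T.filter (fun t => x₁ < t 0 ∧ t 0 < x₂) with hMdef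
  have hL' : ∀ t ∈ L, t 0 ≤ x₁ := fun t ht => (Finset.mem_filter.1 ht).2.le
  have hR' : ∀ t ∈ R, x₂ ≤ t 0 := fun t ht => (Finset.mem_filter.1 ht).2.le
  have hM' : ∀ t ∈ M, x₁ ≤ t 0 ∧ t 0 ≤ x₂ := fun t ht =>
    ⟨(Finset.mem_filter.1 ht).2.1.le, (Finset.mem_filter.1 ht).2.2.le⟩
  -- In the horizontal projection, a line bisects the left and right parts. Keeping their halves on
  -- one side, and the points of the middle part on the other, excludes a line meeting all three
  -- convex hulls.
  obtain ⟨α, β, hαβ⟩ := exists_bisecting_line (A := L) (B := R) (Finset.card_pos.1 (by omega))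
    (Finset.card_pos.1 (by omega)) (fun t => t 0) (fun t => t 1) hx hL' hR'
  obtain ⟨hL1, hL2⟩ := hαβ L (Or.inl rfl)
  obtain ⟨hR1, hR2⟩ := hαβ R (Or.inr rfl)
  -- a side of the line that contains many points of the middle part
  have hside : ∃ σ : ℝ, (σ = 1 ∨ σ = -1) ∧
      T.card ≤ 10 * (M.filter (fun t => 0 < σ * (t 1 + α * t 0 - β))).card ∧
      T.card ≤ 10 * (L.filter (fun t => σ * (t 1 + α * t 0 - β) ≤ 0)).card ∧
      T.card ≤ 10 * (R.filter (fun t => σ * (t 1 + α * t 0 - β) ≤ 0)).card := by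
    -- Half of a quarter is an eighth; the at most two middle points on the line itself reduce this
    -- to a tenth.
    have hon : (M.filter (fun t => t 1 + α * t 0 = β)).card ≤ 2 := by
      refine (Finset.card_le_card ?_).trans
        (hT.card_line_le (a := α) (b := 1) (c := β) (Or.inr one_ne_zero))
      intro t ht
      rw [Finset.mem_filter] at ht ⊢
      exact ⟨Finset.mem_of_mem_filter t ht.1, by linarith [ht.2]⟩
    have hcover : M.card ≤ (M.filter (fun t => t 1 + α * t 0 = β)).card +
        (M.filter (fun t => β < t 1 + α * t 0)).card +
        (M.filter (fun t => t 1 + α * t 0 < β)).card := by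
      have : M ⊆ (M.filter (fun t => t 1 + α * t 0 = β) ∪
          M.filter (fun t => β < t 1 + α * t 0)) ∪ M.filter (fun t => t 1 + α * t 0 < β) := by
        intro t ht
        simp only [Finset.mem_filter, Finset.mem_union, ht, true_and]
        rcases lt_trichotomy (t 1 + α * t 0) β with h | h | h
        · exact Or.inr h
        · exact Or.inl (Or.inl h)
        · exact Or.inl (Or.inr h)
      refine (Finset.card_le_card this).trans ((Finset.card_union_le _ _).trans ?_)
      exact Nat.add_le_add_right (Finset.card_union_le _ _) _
    by_cases hcase : (M.filter (fun t => t 1 + α * t 0 < β)).card ≤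
        (M.filter (fun t => β < t 1 + α * t 0)).card
    · refine ⟨1, Or.inl rfl, ?_, ?_, ?_⟩ <;> simp only [one_mul, sub_pos, sub_nonpos] <;> omega
    · refine ⟨-1, Or.inr rfl, ?_, ?_, ?_⟩ <;>
        simp only [neg_mul, one_mul, neg_sub, sub_pos, sub_nonpos] <;> omega
  obtain ⟨σ, hσ, hD, hA, hB⟩ := hside
  set y : E3 → ℝ := fun t => σ * (t 1 + α * t 0 - β) with hy
  set A := L.filter (fun t => y t ≤ 0) with hAdef
  set B := R.filter (fun t => y t ≤ 0) with hBdef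
  set D := M.filter (fun t => 0 < y t) with hDdef
  have hA' : ∀ t ∈ A, t 0 ≤ x₁ := fun t ht => hL' t (Finset.mem_of_mem_filter t ht)
  have hB' : ∀ t ∈ B, x₂ ≤ t 0 := fun t ht => hR' t (Finset.mem_of_mem_filter t ht)
  have hD' : ∀ t ∈ D, x₁ ≤ t 0 ∧ t 0 ≤ x₂ := fun t ht => hM' t (Finset.mem_of_mem_filter t ht)
  have hAy : ∀ t ∈ A, y t ≤ 0 := fun t ht => (Finset.mem_filter.1 ht).2
  have hBy : ∀ t ∈ B, y t ≤ 0 := fun t ht => (Finset.mem_filter.1 ht).2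
  have hDy : ∀ t ∈ D, 0 < y t := fun t ht => (Finset.mem_filter.1 ht).2
  have hD₀ : D.Nonempty := Finset.card_pos.1 (by omega)
  obtain ⟨d, hd, hdmin⟩ := D.exists_min_image y hD₀
  obtain ⟨u, v, w, huvw⟩ := exists_bisecting_plane (A := A) (B := B) (D := D)
    (Finset.card_pos.1 (by omega)) (Finset.card_pos.1 (by omega)) hD₀
    (fun t => t 0) y (fun t => t 2) hx (hDy d hd) hA' hB' hD' hAy hBy hdmin
  -- These coordinates turn the bisecting affine function, written in `t 0`, `y t` and `t 2`, into
  -- `ev t l`.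
  set l : E3 := !₂[u + v * σ * α, v * σ, w + v * σ * β] with hl
  have hl0 : l 0 = u + v * σ * α := by simp [hl]
  have hl1 : l 1 = v * σ := by simp [hl]
  have hl2 : l 2 = w + v * σ * β := by simp [hl]
  have hev : ∀ t, ev t l = w - (t 2 + u * t 0 + v * y t) := by
    intro t
    rw [ev, hl0, hl1, hl2, hy]
    ring
  refine ⟨l, A, B, D, ?_, ?_⟩
  · intro S hS
    have h1 := huvw S hS
    have h2 : T.card ≤ 10 * S.card := by
      rcases hS with rfl | rfl | rfl <;> assumption
    have h3 : S ⊆ T := by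
      rcases hS with rfl | rfl | rfl <;>
        exact (Finset.filter_subset _ _).trans (Finset.filter_subset _ _)
    refine ⟨h3, ?_, ?_⟩
    · simp only [hev, sub_nonneg]
      omega
    · simp only [hev, sub_nonpos]
      omega
  · intro q hq
    have hσ2 : σ * σ = 1 := by rcases hσ with rfl | rfl <;> norm_num
    -- The height `t 2` cancels: the difference is an affine function of `t 0` and `y t` alone, and
    -- it vanishes identically only for `q = l`.
    have hdiff : ∀ t : E3, ev t q - ev t l =
        ((q 2 - l 2) - (q 1 - l 1) * β) + (-(q 0 - l 0) + (q 1 - l 1) * α) * t 0 +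
          (-(q 1 - l 1) * σ) * y t := by
      intro t
      simp only [ev, hy]
      linear_combination (q 1 - l 1) * (t 1 + α * t 0 - β) * hσ2
    have hne : (-(q 0 - l 0) + (q 1 - l 1) * α) ≠ 0 ∨ (-(q 1 - l 1) * σ) ≠ 0 ∨
        ((q 2 - l 2) - (q 1 - l 1) * β) ≠ 0 := by
      by_contra! hcon
      obtain ⟨h0, h1, h2⟩ := hcon
      have hσ0 : σ ≠ 0 := by rcases hσ with rfl | rfl <;> norm_num
      have e1 : q 1 - l 1 = 0 := by
        have := (mul_eq_zero.1 h1).resolve_right hσ0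
        linarith
      rw [e1] at h0 h2
      exact hq (e3_ext (by linarith) (by linarith) (by linarith))
    obtain ⟨S, hS, h⟩ := exists_strict_sign hx hA' hB' hD' hAy hBy hDy hne
    refine ⟨S, hS, h.imp (fun h t ht => ?_) (fun h t ht => ?_)⟩
    · have := h t ht
      rw [← hdiff] at this
      linarith
    · have := h t ht
      rw [← hdiff] at this
      linarith

/-! ### Doubling the number of planes. -/

/-- The maximum number of vertices with a fixed number of planes below them, over all arrangements
of at most `N` planes. -/
def maxVertices (N : ℕ) : ℕ :=
  sSup {v | ∃ T m, Generic T ∧ T.card ≤ N ∧ v = (vertices T m).ncard}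

lemma Generic.ncard_vertices_le_max {T : Finset E3} (hT : Generic T) {N : ℕ} (hN : T.card ≤ N)
    (m : ℕ) : (vertices T m).ncard ≤ maxVertices N := by
  refine le_csSup ⟨2 ^ N, ?_⟩ ⟨T, m, hT, hN, rfl⟩
  rintro _ ⟨S, k, hS, hSN, rfl⟩
  exact (hS.ncard_vertices_le k).trans (Nat.pow_le_pow_right (by norm_num) hSN)

lemma maxVertices_le {N C : ℕ}
    (h : ∀ T m, Generic T → T.card ≤ N → (vertices T m).ncard ≤ C) : maxVertices N ≤ C := by
  refine csSup_le ⟨_, ∅, 0, generic_empty, Nat.zero_le _, rfl⟩ ?_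
  rintro _ ⟨T, m, hT, hTN, rfl⟩
  exact h T m hT hTN

/-- Deleting planes strictly below `q` keeps it a vertex and lowers its depth by `P.card`, the same
amount for every such `q`. -/
lemma mem_vertices_sdiff_of_pos {T P : Finset E3} (hP : P ⊆ T) {q : E3} {m : ℕ}
    (hq : q ∈ vertices T m) (h : ∀ t ∈ P, 0 < ev t q) : q ∈ vertices (T \ P) (m - P.card) := by
  constructor
  · refine Eq.trans ?_ hq.1
    congr 1
    ext t
    simp only [Finset.mem_filter, Finset.mem_sdiff]
    exact ⟨fun h' => ⟨h'.1.1, h'.2⟩, fun h' => ⟨⟨h'.1, fun htP => (h t htP).ne' h'.2⟩, h'.2⟩⟩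
  · rw [← hq.2, ← Finset.card_sdiff_of_subset]
    · congr 1
      ext t
      simp only [Finset.mem_filter, Finset.mem_sdiff]
      tauto
    · intro t ht
      exact Finset.mem_filter.2 ⟨hP ht, h t ht⟩

lemma mem_vertices_sdiff_of_neg {T P : Finset E3} {q : E3} {m : ℕ}
    (hq : q ∈ vertices T m) (h : ∀ t ∈ P, ev t q < 0) : q ∈ vertices (T \ P) m := by
  constructor
  · refine Eq.trans ?_ hq.1
    congr 1
    ext t
    simp only [Finset.mem_filter, Finset.mem_sdiff]
    exact ⟨fun h' => ⟨h'.1.1, h'.2⟩, fun h' => ⟨⟨h'.1, fun htP => (h t htP).ne h'.2⟩, h'.2⟩⟩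
  · refine Eq.trans ?_ hq.2
    congr 1
    ext t
    simp only [Finset.mem_filter, Finset.mem_sdiff]
    exact ⟨fun h' => ⟨h'.1.1, h'.2⟩, fun h' => ⟨⟨h'.1, fun htP => (h t htP).not_gt h'.2⟩, h'.2⟩⟩

/-- Suppose `q` is above `l` over a set `S` of the three, in the sense of `ev t l < ev t q`. Then
`q` is strictly above every plane of `S` with `0 ≤ ev t l`, and these planes can be deleted. In the
opposite case those with `ev t l ≤ 0` can be deleted. This gives six smaller arrangements, with `l`
itself as the only possible exception. -/
lemma Generic.ncard_vertices_le_step {T : Finset E3} (hT : Generic T) (hN : 100 ≤ T.card) (m : ℕ)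
    {C : ℕ} (hC : ∀ S, S ⊆ T → T.card ≤ 20 * (T.card - S.card) → ∀ k,
      (vertices S k).ncard ≤ C) : (vertices T m).ncard ≤ 1 + 6 * C := by
  obtain ⟨l, A, B, D, hABD, hq⟩ := hT.exists_bisected hN
  let W : Finset E3 → Set E3 := fun S =>
    vertices (T \ S.filter (fun t => 0 ≤ ev t l)) (m - (S.filter (fun t => 0 ≤ ev t l)).card) ∪
      vertices (T \ S.filter (fun t => ev t l ≤ 0)) m
  have hWfin : ∀ S, (W S).Finite := fun S =>
    ((hT.subset Finset.sdiff_subset).finite_vertices _).union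
      ((hT.subset Finset.sdiff_subset).finite_vertices _)
  have hW : ∀ S, S = A ∨ S = B ∨ S = D → (W S).ncard ≤ C + C := by
    intro S hS
    obtain ⟨h1, h2, h3⟩ := hABD S hS
    refine (Set.ncard_union_le _ _).trans (add_le_add ?_ ?_)
    · refine hC _ Finset.sdiff_subset ?_ _
      have h4 := (Finset.filter_subset (fun t => 0 ≤ ev t l) S).trans h1
      have h5 := Finset.card_le_card h4
      rw [Finset.card_sdiff_of_subset h4]
      omega
    · refine hC _ Finset.sdiff_subset ?_ _
      have h4 := (Finset.filter_subset (fun t => ev t l ≤ 0) S).trans h1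
      have h5 := Finset.card_le_card h4
      rw [Finset.card_sdiff_of_subset h4]
      omega
  have hcover : vertices T m ⊆ {l} ∪ (W A ∪ (W B ∪ W D)) := by
    intro q hqV
    by_cases hql : q = l
    · exact Or.inl hql
    obtain ⟨S, hS, h⟩ := hq q hql
    have hqW : q ∈ W S := by
      rcases h with h | h
      · refine Or.inl (mem_vertices_sdiff_of_pos
          ((Finset.filter_subset _ _).trans (hABD S hS).1) hqV fun t ht => ?_)
        rw [Finset.mem_filter] at ht
        exact ht.2.trans_lt (h t ht.1)
      · refine Or.inr (mem_vertices_sdiff_of_neg hqV fun t ht => ?_)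
        rw [Finset.mem_filter] at ht
        exact (h t ht.1).trans_le ht.2
    rcases hS with rfl | rfl | rfl
    · exact Or.inr (Or.inl hqW)
    · exact Or.inr (Or.inr (Or.inl hqW))
    · exact Or.inr (Or.inr (Or.inr hqW))
  have h1 := Set.ncard_le_ncard hcover
    ((Set.finite_singleton l).union ((hWfin A).union ((hWfin B).union (hWfin D))))
  have h2 := Set.ncard_union_le {l} (W A ∪ (W B ∪ W D))
  have h3 := Set.ncard_union_le (W A) (W B ∪ W D)
  have h4 := Set.ncard_union_le (W B) (W D)
  have h5 := hW A (by simp)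
  have h6 := hW B (by simp)
  have h7 := hW D (by simp)
  rw [Set.ncard_singleton] at h2
  omega

/-- Halving the number of planes costs at most a constant factor. -/
lemma maxVertices_le_half {n : ℕ} (hn : 200 ≤ n) :
    maxVertices n ≤ 7 ^ 40 * (maxVertices (n / 2) + 1) := by
  -- While more than `n / 2` planes remain, each step removes at least `n / 40` of them. The summand
  -- `1` in the bound makes `1 + 6 * C ≤ 7 * C` available, and `200 ≤ n` covers the rounding after
  -- forty steps.
  have key : ∀ j : ℕ, ∀ T m, Generic T → T.card ≤ n / 2 + j * (n / 40) →
      (vertices T m).ncard ≤ 7 ^ j * (maxVertices (n / 2) + 1) := by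
    intro j
    induction j with
    | zero =>
      intro T m hT hTn
      have := hT.ncard_vertices_le_max (N := n / 2) (by simpa using hTn) m
      omega
    | succ j ih =>
      intro T m hT hTn
      have hpos : 1 ≤ 7 ^ j * (maxVertices (n / 2) + 1) := Nat.mul_pos (by positivity) (by omega)
      have hpow : 7 ^ (j + 1) * (maxVertices (n / 2) + 1) =
          7 * (7 ^ j * (maxVertices (n / 2) + 1)) := by ring
      by_cases hsmall : T.card ≤ n / 2
      · have := ih T m hT (by omega)
        omega
      · have := hT.ncard_vertices_le_step (by omega) m
          (C := 7 ^ j * (maxVertices (n / 2) + 1)) (by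
            intro S hS hcard k
            refine ih S k (hT.subset hS) ?_
            have h1 := Finset.card_le_card hS
            have h2 : (j + 1) * (n / 40) = j * (n / 40) + n / 40 := by ring
            omega)
        omega
  exact maxVertices_le fun T m hT hTn => key 40 T m hT (by omega)

/-! ### Planes as sets -/

lemma inner_eq (x v : E3) : inner ℝ x v = x 0 * v 0 + x 1 * v 1 + x 2 * v 2 := by
  simp [PiLp.inner_apply, Fin.sum_univ_three, mul_comm]

/-- The non-vertical plane `z = t₀ x + t₁ y + t₂`. -/
def planeOf (t : E3) : Set E3 := {q | ev t q = 0}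

/-- The non-vertical plane `z = q₂ - q₀ x - q₁ y`. -/
def dualPlane (q : E3) : Set E3 := {t | ev t q = 0}

lemma add_smul_e3_apply (x : E3) (s : ℝ) :
    (x + s • e3) 0 = x 0 ∧ (x + s • e3) 1 = x 1 ∧ (x + s • e3) 2 = x 2 + s := by
  simp [e3]

lemma isVertical_plane_iff {v : E3} (hv : v ≠ 0) (a : ℝ) :
    IsVertical (plane v a) ↔ v 2 = 0 := by
  constructor
  · rintro ⟨x, hx⟩
    have h0 := hx 0
    have h1 := hx 1
    simp only [plane, Set.mem_ofPred_eq, inner_eq, add_smul_e3_apply] at h0 h1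
    linarith
  · intro h2
    have hpos : v 0 * v 0 + v 1 * v 1 ≠ 0 := by
      intro h
      have h0 : v 0 = 0 := by nlinarith [mul_self_nonneg (v 0), mul_self_nonneg (v 1)]
      have h1 : v 1 = 0 := by nlinarith [mul_self_nonneg (v 0), mul_self_nonneg (v 1)]
      exact hv (e3_ext h0 h1 h2)
    refine ⟨(a / (v 0 * v 0 + v 1 * v 1)) • v, fun t => ?_⟩
    simp only [plane, Set.mem_ofPred_eq, inner_eq, add_smul_e3_apply, PiLp.smul_apply, smul_eq_mul,
      h2]
    linear_combination div_mul_cancel₀ a hpos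

lemma planeOf_eq (t : E3) : planeOf t = plane !₂[-t 0, -t 1, 1] (t 2) := by
  ext q
  simp only [planeOf, plane, Set.mem_ofPred_eq, inner_eq, ev]
  simp
  constructor <;> intro h <;> linarith

lemma dualPlane_eq (q : E3) : dualPlane q = plane !₂[q 0, q 1, 1] (q 2) := by
  ext t
  simp only [dualPlane, plane, Set.mem_ofPred_eq, inner_eq, ev]
  simp
  constructor <;> intro h <;> linarith

lemma vec_ne_zero (a b : ℝ) : (!₂[a, b, 1] : E3) ≠ 0 := fun h => by
  have := congrArg (fun x : E3 => x 2) h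
  simp at this

lemma isPlane_planeOf (t : E3) : IsPlane (planeOf t) :=
  ⟨_, vec_ne_zero _ _, _, planeOf_eq t⟩

lemma not_isVertical_planeOf (t : E3) : ¬ IsVertical (planeOf t) := by
  rw [planeOf_eq, isVertical_plane_iff (vec_ne_zero _ _)]
  simp

lemma exists_eq_planeOf {H : Set E3} (h : IsPlane H) (h' : ¬ IsVertical H) :
    ∃ t, H = planeOf t := by
  obtain ⟨v, hv, a, rfl⟩ := h
  rw [isVertical_plane_iff hv] at h'
  refine ⟨!₂[-v 0 / v 2, -v 1 / v 2, a / v 2], ?_⟩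
  ext q
  simp only [planeOf, plane, Set.mem_ofPred_eq, inner_eq, ev]
  simp
  field_simp
  constructor <;> intro h <;> linarith

/-- Every non-vertical plane is a dual plane after division by `v 2`; the sign of `v 2` decides
which of its sides is the lower one. -/
lemma exists_ev_eq_of_not_isVertical {v : E3} (hv : v ≠ 0) {a : ℝ}
    (h : ¬ IsVertical (plane v a)) : ∃ q, ∀ t, ev t q = (a - inner ℝ t v) / v 2 := by
  rw [isVertical_plane_iff hv] at h
  refine ⟨!₂[v 0 / v 2, v 1 / v 2, a / v 2], fun t => ?_⟩
  simp [inner_eq, ev]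
  field_simp
  ring

lemma planeOf_injective : Function.Injective planeOf := by
  intro s t h
  have h0 : (!₂[0, 0, s 2] : E3) ∈ planeOf t := by rw [← h]; simp [planeOf, ev]
  have h1 : (!₂[1, 0, s 0 + s 2] : E3) ∈ planeOf t := by rw [← h]; simp [planeOf, ev]
  have h2 : (!₂[0, 1, s 1 + s 2] : E3) ∈ planeOf t := by rw [← h]; simp [planeOf, ev]
  simp [planeOf, ev] at h0 h1 h2
  exact e3_ext (by linarith) (by linarith) (by linarith)

lemma dualPlane_injective : Function.Injective dualPlane := by
  intro p q h
  have h0 : (!₂[0, 0, p 2] : E3) ∈ dualPlane q := by rw [← h]; simp [dualPlane, ev]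
  have h1 : (!₂[1, 0, p 2 - p 0] : E3) ∈ dualPlane q := by rw [← h]; simp [dualPlane, ev]
  have h2 : (!₂[0, 1, p 2 - p 1] : E3) ∈ dualPlane q := by rw [← h]; simp [dualPlane, ev]
  simp [dualPlane, ev] at h0 h1 h2
  exact e3_ext (by linarith) (by linarith) (by linarith)

lemma passesBelow_planeOf (t q : E3) : PassesBelow (planeOf t) q ↔ 0 < ev t q := by
  have key : ∀ s : ℝ, ev t (q - s • e3) = ev t q - s := by
    intro s
    rw [sub_eq_add_neg, ← neg_smul]
    simp only [ev, add_smul_e3_apply]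
    ring
  constructor
  · rintro ⟨s, hs, h⟩
    have : ev t (q - s • e3) = 0 := h
    rw [key] at this
    linarith
  · intro h
    exact ⟨ev t q, h, show ev t (q - ev t q • e3) = 0 by rw [key, sub_self]⟩

lemma encard_inter_eq (T : Finset E3) (p : E3 → Prop) :
    ((T : Set E3) ∩ {x | p x}).encard = (T.filter p).card := by
  rw [← Set.encard_coe_eq_coe_finsetCard, Finset.coe_filter]
  rfl

/-- Three points whose horizontal projections are collinear lie in a vertical plane. -/
lemma exists_vertical_plane {a b c : E3} (h : cross a b c = 0) :
    ∃ d : E3, d ≠ 0 ∧ d 2 = 0 ∧ ∃ k, a ∈ plane d k ∧ b ∈ plane d k ∧ c ∈ plane d k := by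
  have hcross := h
  unfold cross at hcross
  have fin : ∀ u w : ℝ, (u ≠ 0 ∨ w ≠ 0) → u * (b 0 - a 0) + w * (b 1 - a 1) = 0 →
      u * (c 0 - a 0) + w * (c 1 - a 1) = 0 →
      ∃ d : E3, d ≠ 0 ∧ d 2 = 0 ∧ ∃ k, a ∈ plane d k ∧ b ∈ plane d k ∧ c ∈ plane d k := by
    intro u w huw hb hc
    refine ⟨!₂[u, w, 0], ?_, by simp, a 0 * u + a 1 * w, ?_, ?_, ?_⟩
    · intro h0
      have e0 := congrArg (fun x : E3 => x 0) h0
      have e1 := congrArg (fun x : E3 => x 1) h0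
      simp at e0 e1
      exact huw.elim (fun h => h e0) (fun h => h e1)
    all_goals
      simp only [plane, Set.mem_ofPred_eq, inner_eq]
      simp
    · linarith
    · linarith
  -- The normal is orthogonal to the projection of `b - a`; if that vanishes, to the projection of
  -- `c - a`; if both vanish, any horizontal vector serves.
  by_cases hb0 : b 0 - a 0 = 0
  · by_cases hb1 : b 1 - a 1 = 0
    · by_cases hc0 : c 0 - a 0 = 0
      · exact fin 1 0 (by simp) (by simp [hb0]) (by simp [hc0])
      · exact fin (-(c 1 - a 1)) (c 0 - a 0) (Or.inr hc0) (by simp [hb0, hb1]) (by ring)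
    · exact fin (-(b 1 - a 1)) (b 0 - a 0) (Or.inl (neg_ne_zero.2 hb1)) (by ring) (by linarith)
  · exact fin (-(b 1 - a 1)) (b 0 - a 0) (Or.inr hb0) (by ring) (by linarith)

/-- Two elements with equal projections are collinear in projection with any third element, and
three elements ensure that one exists. -/
lemma Generic.of_triple_of_four {T : Finset E3} (hT : 3 ≤ T.card)
    (h3 : ∀ a ∈ T, ∀ b ∈ T, ∀ c ∈ T, a ≠ b → a ≠ c → b ≠ c → cross a b c ≠ 0)
    (h4 : ∀ q, (T.filter (fun t => ev t q = 0)).card ≤ 3) : Generic T where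
  pair a ha b hb hab := by
    have hlt : ({a, b} : Finset E3).card < T.card := by
      rw [Finset.card_pair hab]
      omega
    obtain ⟨c, hc, hcab⟩ := Finset.exists_mem_notMem_of_card_lt_card hlt
    simp only [Finset.mem_insert, Finset.mem_singleton, not_or] at hcab
    by_contra! hcon
    refine h3 a ha b hb c hc hab (Ne.symm hcab.1) (Ne.symm hcab.2) ?_
    rw [cross, hcon.1, hcon.2]
    ring
  triple := h3
  four := h4

/-! ### Halving planes -/

lemma generic_of_pointsInGeneralPosition {T : Finset E3} (hT : 3 ≤ T.card)
    (h : PointsInGeneralPosition (T : Set E3)) : Generic T := by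
  refine Generic.of_triple_of_four hT ?_ fun q => ?_
  · intro a ha b hb c hc hab hac hbc hcross
    obtain ⟨d, hd, hd2, k, hak, hbk, hck⟩ := exists_vertical_plane hcross
    have := h.not_three (plane d k) ⟨d, hd, k, rfl⟩ ((isVertical_plane_iff hd k).2 hd2)
    have hsub : (({a, b, c} : Finset E3) : Set E3) ⊆ (T : Set E3) ∩ plane d k := by
      intro x hx
      simp only [Finset.coe_insert, Finset.coe_singleton, Set.mem_insert_iff,
        Set.mem_singleton_iff] at hx
      rcases hx with rfl | rfl | rfl
      exacts [⟨ha, hak⟩, ⟨hb, hbk⟩, ⟨hc, hck⟩]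
    have h3 := (Set.encard_le_encard hsub).trans this
    rw [Set.encard_coe_eq_coe_finsetCard, Finset.card_eq_three.2 ⟨a, b, c, hab, hac, hbc, rfl⟩] at h3
    exact absurd h3 (by norm_num)
  · have := h.not_four (dualPlane q) ⟨_, vec_ne_zero _ _, _, dualPlane_eq q⟩
    rw [dualPlane, encard_inter_eq] at this
    exact_mod_cast this

lemma Generic.pointsInGeneralPosition {T : Finset E3} (hT : Generic T)
    (h2 : ∀ a ∈ T, ∀ b ∈ T, a 2 = b 2 → a = b) : PointsInGeneralPosition (T : Set E3) := by
  have hvert : ∀ H, IsPlane H → IsVertical H → ((T : Set E3) ∩ H).encard ≤ 2 := by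
    rintro _ ⟨v, hv, a, rfl⟩ hvert
    rw [isVertical_plane_iff hv] at hvert
    have hv' : v 0 ≠ 0 ∨ v 1 ≠ 0 := by
      by_contra! hcon
      exact hv (e3_ext hcon.1 hcon.2 hvert)
    rw [plane, encard_inter_eq]
    have := hT.card_line_le (c := a) hv'
    have heq : T.filter (fun x => inner ℝ x v = a) =
        T.filter (fun t => v 0 * t 0 + v 1 * t 1 = a) := by
      refine Finset.filter_congr fun t _ => ?_
      rw [inner_eq, hvert, mul_zero, add_zero, mul_comm (t 0), mul_comm (t 1)]
    rw [heq]
    exact_mod_cast this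
  refine ⟨?_, hvert, ?_⟩
  · intro H hH
    by_cases hv : IsVertical H
    · exact (hvert H hH hv).trans (by norm_num)
    · obtain ⟨v, hv0, a, rfl⟩ := hH
      obtain ⟨q, hq⟩ := exists_ev_eq_of_not_isVertical hv0 hv
      rw [isVertical_plane_iff hv0] at hv
      have heq : T.filter (fun x => inner ℝ x v = a) = T.filter (fun t => ev t q = 0) := by
        refine Finset.filter_congr fun t _ => ?_
        rw [hq, div_eq_zero_iff, or_iff_left hv, sub_eq_zero, eq_comm]
      rw [plane, encard_inter_eq, heq]
      exact_mod_cast hT.four q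
  · rintro _ ⟨c, rfl⟩
    rw [Set.encard_le_one_iff]
    intro a b ha hb
    exact h2 a ha.1 b hb.1 (by rw [show a 2 = c from ha.2, show b 2 = c from hb.2])

/-- The `T.card - 3` points off the plane are split with difference at most one exactly when the
number below is the floor or the ceiling of their half. The two values coincide for odd `T.card`. -/
lemma PointsInGeneralPosition.setOf_isHalvingPlane_eq {T : Finset E3}
    (hP : PointsInGeneralPosition (T : Set E3)) :
    {H | IsHalvingPlane (T : Set E3) H} =
      dualPlane '' (vertices T ((T.card - 3) / 2) ∪ vertices T ((T.card - 2) / 2)) := by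
  have hsum : ∀ q, (T.filter (fun t => ev t q = 0)).card + (T.filter (fun t => 0 < ev t q)).card +
      (T.filter (fun t => ev t q < 0)).card = T.card := by
    intro q
    have h1 := Finset.card_filter_add_card_filter_not (s := T) (fun t => ev t q < 0)
    have h2 := Finset.card_filter_add_card_filter_not
      (s := T.filter (fun t => ¬ ev t q < 0)) (fun t => 0 < ev t q)
    rw [Finset.filter_filter, Finset.filter_filter] at h2
    have h3 : T.filter (fun t => ¬ ev t q < 0 ∧ 0 < ev t q) = T.filter (fun t => 0 < ev t q) :=
      Finset.filter_congr fun t _ => ⟨fun h => h.2, fun h => ⟨not_lt.2 h.le, h⟩⟩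
    have h4 : T.filter (fun t => ¬ ev t q < 0 ∧ ¬ 0 < ev t q) = T.filter (fun t => ev t q = 0) :=
      Finset.filter_congr fun t _ =>
        ⟨fun h => le_antisymm (not_lt.1 h.2) (not_lt.1 h.1), fun h => by simp [h]⟩
    rw [h3, h4] at h2
    omega
  ext H
  constructor
  · rintro ⟨v, hv, a, rfl, h3, hle, hle'⟩
    have hvert : ¬ IsVertical (plane v a) := by
      intro h
      have := hP.not_three _ ⟨v, hv, a, rfl⟩ h
      rw [h3] at this
      exact absurd this (by norm_num)
    obtain ⟨q, hq⟩ := exists_ev_eq_of_not_isVertical hv hvert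
    rw [isVertical_plane_iff hv] at hvert
    have hz : ∀ t, ev t q = 0 ↔ inner ℝ t v = a := by
      intro t
      rw [hq, div_eq_zero_iff, or_iff_left hvert, sub_eq_zero, eq_comm]
    rw [plane, encard_inter_eq] at h3
    rw [posSide, negSide, encard_inter_eq, encard_inter_eq] at hle hle'
    simp only [← hz] at h3
    have h3' : (T.filter (fun t => ev t q = 0)).card = 3 := by exact_mod_cast h3
    refine ⟨q, ?_, ?_⟩
    · have key : (T.filter (fun t => 0 < ev t q)).card ≤
          (T.filter (fun t => ev t q < 0)).card + 1 ∧
          (T.filter (fun t => ev t q < 0)).card ≤ (T.filter (fun t => 0 < ev t q)).card + 1 := by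
        -- The positive side of `plane v a` is below the plane when `v 2` is negative and above it
        -- otherwise.
        rcases lt_or_gt_of_ne hvert with hneg | hpos
        · have e1 : ∀ t, 0 < ev t q ↔ a < inner ℝ t v := fun t => by
            rw [hq, lt_div_iff_of_neg hneg, zero_mul, sub_neg]
          have e2 : ∀ t, ev t q < 0 ↔ inner ℝ t v < a := fun t => by
            rw [hq, div_lt_iff_of_neg hneg, zero_mul, sub_pos]
          simp only [e1, e2]
          exact ⟨by exact_mod_cast hle, by exact_mod_cast hle'⟩
        · have e1 : ∀ t, 0 < ev t q ↔ inner ℝ t v < a := fun t => by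
            rw [hq, div_pos_iff_of_pos_right hpos, sub_pos]
          have e2 : ∀ t, ev t q < 0 ↔ a < inner ℝ t v := fun t => by
            rw [hq, div_lt_iff₀ hpos, zero_mul, sub_neg]
          simp only [e1, e2]
          exact ⟨by exact_mod_cast hle', by exact_mod_cast hle⟩
      have := hsum q
      have : (T.filter (fun t => 0 < ev t q)).card = (T.card - 3) / 2 ∨
          (T.filter (fun t => 0 < ev t q)).card = (T.card - 2) / 2 := by omega
      exact this.imp (fun h => ⟨h3', h⟩) (fun h => ⟨h3', h⟩)
    · ext t
      exact hz t
  · rintro ⟨q, hq, rfl⟩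
    have h3 : (T.filter (fun t => ev t q = 0)).card = 3 := hq.elim (fun h => h.1) (fun h => h.1)
    have hm : (T.filter (fun t => 0 < ev t q)).card = (T.card - 3) / 2 ∨
        (T.filter (fun t => 0 < ev t q)).card = (T.card - 2) / 2 :=
      hq.imp (fun h => h.2) (fun h => h.2)
    have hin : ∀ t : E3, inner ℝ t (!₂[q 0, q 1, 1] : E3) = q 2 - ev t q := by
      intro t
      rw [inner_eq]
      simp [ev]
      ring
    refine ⟨_, vec_ne_zero (q 0) (q 1), q 2, dualPlane_eq q, ?_, ?_⟩
    · rw [dualPlane, encard_inter_eq, h3]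
      rfl
    · rw [posSide, negSide, encard_inter_eq, encard_inter_eq]
      simp only [hin, sub_lt_self_iff, lt_sub_iff_add_lt, add_lt_iff_neg_left]
      have := hsum q
      constructor <;> norm_cast <;> omega

lemma halvingCounts_le {n m : ℕ} (h : m ∈ halvingCounts n) : m ≤ 2 * maxVertices n := by
  obtain ⟨P, hfin, hn, hP, rfl⟩ := h
  lift P to Finset E3 using hfin
  rw [Set.ncard_coe_finset] at hn
  by_cases h3 : 3 ≤ P.card
  · have hG := generic_of_pointsInGeneralPosition h3 hP
    rw [hP.setOf_isHalvingPlane_eq, Set.ncard_image_of_injective _ dualPlane_injective]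
    refine (Set.ncard_union_le _ _).trans ?_
    have h1 := hG.ncard_vertices_le_max hn.le ((P.card - 3) / 2)
    have h2 := hG.ncard_vertices_le_max hn.le ((P.card - 2) / 2)
    omega
  · have : {H | IsHalvingPlane (P : Set E3) H} = ∅ := by
      rw [Set.eq_empty_iff_forall_notMem]
      rintro H ⟨v, -, a, -, hH, -⟩
      have h1 := Set.encard_le_encard (Set.inter_subset_left : (P : Set E3) ∩ H ⊆ P)
      rw [hH, Set.encard_coe_eq_coe_finsetCard] at h1
      exact h3 (by exact_mod_cast h1)
    rw [this, Set.ncard_empty]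
    exact Nat.zero_le _

/-- A vertical shear makes the heights of the points distinct. -/
lemma Generic.exists_shear {T : Finset E3} (hT : Generic T) :
    ∃ S : Finset E3, Generic S ∧ S.card = T.card ∧ (∀ a ∈ S, ∀ b ∈ S, a 2 = b 2 → a = b) ∧
      ∀ m, (vertices S m).ncard = (vertices T m).ncard := by
  have hdense : ∀ p ∈ T.offDiag, Dense {x : E3 |
      (p.1 2 - p.2 2) + x 0 * (p.1 0 - p.2 0) + x 1 * (p.1 1 - p.2 1) ≠ 0} := by
    rintro ⟨a, b⟩ hp
    rw [Finset.mem_offDiag] at hp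
    rcases hT.pair a hp.1 b hp.2.1 hp.2.2 with h | h
    · exact dense_setOf_ne_zero (d := !₂[1, 0, 0]) (sub_ne_zero.2 h) (fun t s => by simp; ring)
    · exact dense_setOf_ne_zero (d := !₂[0, 1, 0]) (sub_ne_zero.2 h) (fun t s => by simp; ring)
  have hopen : ∀ p ∈ T.offDiag, IsOpen {x : E3 |
      (p.1 2 - p.2 2) + x 0 * (p.1 0 - p.2 0) + x 1 * (p.1 1 - p.2 1) ≠ 0} := fun p _ =>
    isOpen_ne_fun (by fun_prop) continuous_const
  obtain ⟨x, hx⟩ := (dense_inter_finset T.offDiag isOpen_univ dense_univ hopen hdense).nonempty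
  simp only [Set.mem_inter_iff, Set.mem_univ, true_and, Set.mem_iInter] at hx
  -- Adding a linear function of the horizontal coordinates to the heights is compensated in `ev` by
  -- a horizontal translation of `q`.
  set f : E3 → E3 := fun t => !₂[t 0, t 1, t 2 + x 0 * t 0 + x 1 * t 1] with hf
  set g : E3 → E3 := fun q => !₂[q 0 - x 0, q 1 - x 1, q 2] with hg
  have f0 : ∀ t, f t 0 = t 0 := fun t => by simp [hf]
  have f1 : ∀ t, f t 1 = t 1 := fun t => by simp [hf]
  have f2 : ∀ t, f t 2 = t 2 + x 0 * t 0 + x 1 * t 1 := fun t => by simp [hf]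
  have hfinj : Function.Injective f := by
    intro s t h
    have h0 := congrArg (fun p : E3 => p 0) h
    have h1 := congrArg (fun p : E3 => p 1) h
    have h2 := congrArg (fun p : E3 => p 2) h
    simp only [f0, f1, f2] at h0 h1 h2
    rw [h0, h1] at h2
    exact e3_ext h0 h1 (by linarith)
  have hginj : Function.Injective g := by
    intro s t h
    have h0 := congrArg (fun p : E3 => p 0) h
    have h1 := congrArg (fun p : E3 => p 1) h
    have h2 := congrArg (fun p : E3 => p 2) h
    simp [hg] at h0 h1 h2
    exact e3_ext h0 h1 h2
  have hgsurj : ∀ q, ∃ p, g p = q := fun q =>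
    ⟨!₂[q 0 + x 0, q 1 + x 1, q 2], e3_ext (by simp [hg]) (by simp [hg]) (by simp [hg])⟩
  have hev : ∀ t q, ev (f t) (g q) = ev t q := by
    intro t q
    simp only [ev, f0, f1, f2]
    simp [hg]
    ring
  have hcard : ∀ (p : ℝ → Prop) (q : E3), ((T.image f).filter (fun t => p (ev t (g q)))).card =
      (T.filter (fun t => p (ev t q))).card := by
    intro p q
    rw [Finset.filter_image, Finset.card_image_of_injective _ hfinj]
    simp only [hev]
  refine ⟨T.image f, ⟨?_, ?_, ?_⟩, Finset.card_image_of_injective _ hfinj, ?_, ?_⟩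
  · simp only [Finset.forall_mem_image, f0, f1]
    intro a ha b hb hab
    exact hT.pair a ha b hb fun h => hab (by rw [h])
  · simp only [Finset.forall_mem_image, cross, f0, f1]
    intro a ha b hb c hc hab hac hbc
    exact hT.triple a ha b hb c hc (fun h => hab (by rw [h])) (fun h => hac (by rw [h]))
      (fun h => hbc (by rw [h]))
  · intro q
    obtain ⟨p, rfl⟩ := hgsurj q
    rw [hcard (fun r => r = 0)]
    exact hT.four p
  · simp only [Finset.forall_mem_image, f2]
    intro a ha b hb h
    by_contra hab
    exact hx (a, b) (Finset.mem_offDiag.2 ⟨ha, hb, fun h' => hab (congrArg f h')⟩) (by linarith)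
  · intro m
    have : vertices (T.image f) m = g '' vertices T m := by
      ext q
      obtain ⟨p, rfl⟩ := hgsurj q
      rw [hginj.mem_set_image]
      simp only [vertices, Set.mem_ofPred_eq, hcard (fun r => r = 0), hcard (fun r => 0 < r)]
    rw [this, Set.ncard_image_of_injective _ hginj]

lemma exists_mem_halvingCounts {T : Finset E3} (hT : Generic T) {m : ℕ}
    (hm : (vertices T m).Nonempty → m = (T.card - 3) / 2) :
    ∃ k ∈ halvingCounts T.card, (vertices T m).ncard ≤ k := by
  obtain ⟨S, hS, hcard, h2, hv⟩ := hT.exists_shear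
  have hP := hS.pointsInGeneralPosition h2
  refine ⟨_, ⟨S, S.finite_toSet, by rw [Set.ncard_coe_finset, hcard], hP, rfl⟩, ?_⟩
  rcases (vertices T m).eq_empty_or_nonempty with h0 | hne
  · simp [h0]
  · rw [hP.setOf_isHalvingPlane_eq, Set.ncard_image_of_injective _ dualPlane_injective,
      ← hv m, hm hne, hcard]
    exact Set.ncard_le_ncard Set.subset_union_left
      ((hS.finite_vertices _).union (hS.finite_vertices _))

lemma isGreatest_halvingCounts (n : ℕ) : IsGreatest (halvingCounts n) (h₃ n) := by
  have hbdd : BddAbove (halvingCounts n) := ⟨2 * maxVertices n, fun _ h => halvingCounts_le h⟩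
  refine ⟨Nat.sSup_mem ?_ hbdd, fun _ h => le_csSup hbdd h⟩
  obtain ⟨T, hT, rfl⟩ := exists_generic n
  obtain ⟨S, hS, hcard, h2, -⟩ := hT.exists_shear
  exact ⟨_, S, S.finite_toSet, by rw [Set.ncard_coe_finset, hcard],
    hS.pointsInGeneralPosition h2, rfl⟩

lemma h₃_le (n : ℕ) : h₃ n ≤ 2 * maxVertices n := halvingCounts_le (isGreatest_halvingCounts n).1

lemma ncard_filter_union {T X : Finset E3} (hX : Disjoint X T) (p : E3 → Prop) :
    ((T ∪ X).filter p).card = (T.filter p).card + (X.filter p).card := by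
  rw [Finset.filter_union, Finset.card_union_of_disjoint]
  exact Finset.disjoint_filter_filter hX.symm

/-- Planes `X` far below the vertices raise the depth of each from `m` to `(n - 3) / 2`; planes `Y`
far above bring the total to `n` without affecting it. There is room because `m + 3 ≤ T.card ≤ n /
2`. -/
lemma maxVertices_half_le_h₃ (n : ℕ) : maxVertices (n / 2) ≤ h₃ n := by
  refine maxVertices_le fun T m hT hcard => ?_
  rcases (vertices T m).eq_empty_or_nonempty with h0 | ⟨p, hp⟩
  · simp [h0]
  have hm : m + 3 ≤ T.card := by
    rw [← hp.1, ← hp.2, ← Finset.card_union_of_disjoint]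
    · exact Finset.card_le_card (Finset.union_subset (Finset.filter_subset _ _)
        (Finset.filter_subset _ _))
    · exact Finset.disjoint_filter.2 fun t _ h h' => h.ne' h'
  obtain ⟨X, hX, hXc, hXG, hXpos⟩ := hT.exists_extension (hT.finite_vertices m) 1 one_ne_zero
    ((n - 3) / 2 - m)
  obtain ⟨Y, hY, hYc, hYG, hYneg⟩ := hXG.exists_extension (hT.finite_vertices m) (-1) (by simp)
    (n - T.card - ((n - 3) / 2 - m))
  have hcardTX : (T ∪ X).card = T.card + X.card := Finset.card_union_of_disjoint hX.symm
  have hcardTXY : (T ∪ X ∪ Y).card = n := by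
    rw [Finset.card_union_of_disjoint hY.symm, hcardTX, hXc, hYc]
    omega
  have hsub : vertices T m ⊆ vertices (T ∪ X ∪ Y) ((n - 3) / 2) := by
    intro q hq
    have hX0 : X.filter (fun t => ev t q = 0) = ∅ := Finset.filter_false_of_mem fun t ht => by
      have := hXpos t ht q hq
      intro h
      rw [h] at this
      simp at this
    have hY0 : Y.filter (fun t => ev t q = 0) = ∅ := Finset.filter_false_of_mem fun t ht => by
      have := hYneg t ht q hq
      intro h
      rw [h] at this
      simp at this
    have hX1 : X.filter (fun t => 0 < ev t q) = X := Finset.filter_true_of_mem fun t ht => by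
      have := hXpos t ht q hq
      linarith
    have hY1 : Y.filter (fun t => 0 < ev t q) = ∅ := Finset.filter_false_of_mem fun t ht => by
      have := hYneg t ht q hq
      linarith
    refine ⟨?_, ?_⟩
    · rw [ncard_filter_union hY, ncard_filter_union hX, hX0, hY0, hq.1]
      rfl
    · rw [ncard_filter_union hY, ncard_filter_union hX, hX1, hY1, hq.2, hXc, Finset.card_empty]
      omega
  obtain ⟨k, hk, hle⟩ := exists_mem_halvingCounts hYG (m := (n - 3) / 2) (fun _ => by
    rw [hcardTXY])
  rw [hcardTXY] at hk
  exact (Set.ncard_le_ncard hsub (hYG.finite_vertices _)).trans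
    (hle.trans ((isGreatest_halvingCounts n).2 hk))

/-! ### Cells and levels in coordinates -/

lemma exists_finset_eq_image {A : Set (Set E3)} (hA : A.Finite) (h : ∀ H ∈ A, IsPlane H)
    (h' : ∀ H ∈ A, ¬ IsVertical H) : ∃ T : Finset E3, A = planeOf '' T := by
  refine ⟨(hA.preimage planeOf_injective.injOn).toFinset, ?_⟩
  rw [Set.Finite.coe_toFinset, Set.image_preimage_eq_iff.2]
  intro H hH
  obtain ⟨t, rfl⟩ := exists_eq_planeOf (h H hH) (h' H hH)
  exact ⟨t, rfl⟩

lemma sameCell_iff {T : Finset E3} {x y : E3} : SameCell (planeOf '' T) x y ↔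
    ∀ t ∈ T, (ev t x = 0 ↔ ev t y = 0) ∧ (0 < ev t x ↔ 0 < ev t y) := by
  simp only [SameCell, Set.forall_mem_image, passesBelow_planeOf]
  rfl

lemma encard_setOf_mem_image (T : Finset E3) (p : Set E3 → Prop) :
    {H | H ∈ planeOf '' T ∧ p H}.encard = (T.filter (fun t => p (planeOf t))).card := by
  have : {H | H ∈ planeOf '' T ∧ p H} = planeOf '' (T.filter (fun t => p (planeOf t))) := by
    ext H
    constructor
    · rintro ⟨⟨t, ht, rfl⟩, hp⟩
      exact ⟨t, Finset.mem_coe.2 (Finset.mem_filter.2 ⟨ht, hp⟩), rfl⟩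
    · rintro ⟨t, ht, rfl⟩
      have := Finset.mem_filter.1 (Finset.mem_coe.1 ht)
      exact ⟨⟨t, this.1, rfl⟩, this.2⟩
  rw [this, planeOf_injective.encard_image, Set.encard_coe_eq_coe_finsetCard]

lemma level_eq (T : Finset E3) (k : ℕ) : level (planeOf '' T) k =
    closure {x | (T.filter (fun t => ev t x = 0)).card = 1 ∧
      (T.filter (fun t => 0 < ev t x)).card + 1 = k} := by
  unfold level
  congr 1
  ext x
  have h1 : (∃! H, H ∈ planeOf '' (T : Set E3) ∧ x ∈ H) ↔
      (T.filter (fun t => ev t x = 0)).card = 1 := by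
    have h2 := encard_setOf_mem_image T (fun H => x ∈ H)
    have h3 : (∃! H, H ∈ planeOf '' (T : Set E3) ∧ x ∈ H) ↔
        {H | H ∈ planeOf '' (T : Set E3) ∧ x ∈ H}.encard = 1 := by
      rw [Set.encard_eq_one]
      constructor
      · rintro ⟨H, hH, hu⟩
        exact ⟨H, Set.eq_singleton_iff_unique_mem.2 ⟨hH, hu⟩⟩
      · rintro ⟨H, hH⟩
        have := Set.eq_singleton_iff_unique_mem.1 hH
        exact ⟨H, this.1, this.2⟩
    rw [h3, h2]
    exact Nat.cast_eq_one
  have h4 := encard_setOf_mem_image T (fun H => PassesBelow H x)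
  simp only [passesBelow_planeOf] at h4
  simp only [Set.mem_ofPred_eq, h1, h4]
  norm_cast

/-- The planes strictly above or strictly below a point keep their position near that point. -/
lemma eventually_sign (T : Finset E3) (x : E3) :
    ∀ᶠ y in 𝓝 x, ∀ t ∈ T, (0 < ev t x → 0 < ev t y) ∧ (ev t x < 0 → ev t y < 0) := by
  rw [eventually_all_finset]
  intro t _
  have hc := (continuous_ev_right t).tendsto x
  refine Filter.Eventually.and ?_ ?_
  · by_cases h : 0 < ev t x
    · exact (hc.eventually (lt_mem_nhds h)).mono fun _ h' _ => h'
    · exact Eventually.of_forall fun _ h' => absurd h' h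
  · by_cases h : ev t x < 0
    · exact (hc.eventually (gt_mem_nhds h)).mono fun _ h' _ => h'
    · exact Eventually.of_forall fun _ h' => absurd h' h

/-- Compare `x` with a nearby point `y` of the set whose closure is the level. Planes strictly below
`x` stay below `y`, and planes through or below `y` are through or below `x`. As `y` is on exactly
one plane, `k` counts the planes through or below `y`. -/
lemma card_le_of_mem_level {T : Finset E3} {k : ℕ} {x : E3} (hx : x ∈ level (planeOf '' T) k) :
    (T.filter (fun t => 0 < ev t x)).card + 1 ≤ k ∧
      k ≤ (T.filter (fun t => 0 < ev t x)).card + (T.filter (fun t => ev t x = 0)).card := by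
  rw [level_eq, mem_closure_iff_nhds] at hx
  obtain ⟨y, hy, hy1, hyk⟩ := hx _ (eventually_sign T x)
  have h1 : (T.filter (fun t => 0 < ev t x)).card ≤ (T.filter (fun t => 0 < ev t y)).card :=
    Finset.card_le_card fun t ht => by
      rw [Finset.mem_filter] at ht ⊢
      exact ⟨ht.1, (hy t ht.1).1 ht.2⟩
  have h2 : (T.filter (fun t => 0 < ev t y)).card + (T.filter (fun t => ev t y = 0)).card ≤
      (T.filter (fun t => 0 < ev t x)).card + (T.filter (fun t => ev t x = 0)).card := by
    rw [← Finset.card_union_of_disjoint (Finset.disjoint_filter.2 fun t _ h h' => h.ne' h'),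
      ← Finset.card_union_of_disjoint (Finset.disjoint_filter.2 fun t _ h h' => h.ne' h')]
    refine Finset.card_le_card fun t ht => ?_
    simp only [Finset.mem_union, Finset.mem_filter] at ht ⊢
    have htT : t ∈ T := ht.elim (fun h => h.1) (fun h => h.1)
    rcases lt_trichotomy (ev t x) 0 with h | h | h
    · have := (hy t htT).2 h
      rcases ht with ht | ht
      · exact absurd ht.2 this.not_gt
      · exact absurd ht.2 this.ne
    · exact Or.inr ⟨htT, h⟩
    · exact Or.inl ⟨htT, h⟩
  omega

/-- The cell of the arrangement that contains the point `x`. -/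
def cellAt (T : Finset E3) (x : E3) : Set E3 := {y | SameCell (planeOf '' T) x y}

lemma mem_cellAt_self (T : Finset E3) (x : E3) : x ∈ cellAt T x :=
  sameCell_iff.2 fun _ _ => ⟨Iff.rfl, Iff.rfl⟩

lemma cells_eq_range (T : Finset E3) : cells (planeOf '' T) = Set.range (cellAt T) := by
  ext C
  exact ⟨fun ⟨x, hx⟩ => ⟨x, hx.symm⟩, fun ⟨x, hx⟩ => ⟨x, hx.symm⟩⟩

/-- A cell is determined by the set of planes through it and the set of planes below it. -/
lemma finite_cells_and_ncard_le (T : Finset E3) :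
    (cells (planeOf '' T)).Finite ∧ (cells (planeOf '' T)).ncard ≤ 4 ^ T.card := by
  have hsub : ∃ f : Finset E3 × Finset E3 → Set E3,
      cells (planeOf '' T) ⊆ f '' ((T.powerset ×ˢ T.powerset : Finset _) : Set _) := by
    refine ⟨fun p => {y | T.filter (fun t => ev t y = 0) = p.1 ∧
      T.filter (fun t => 0 < ev t y) = p.2}, ?_⟩
    rintro _ ⟨x, rfl⟩
    refine ⟨(T.filter (fun t => ev t x = 0), T.filter (fun t => 0 < ev t x)), ?_, ?_⟩
    · exact Finset.mem_coe.2 (Finset.mem_product.2 ⟨Finset.mem_powerset.2 (Finset.filter_subset _ _),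
        Finset.mem_powerset.2 (Finset.filter_subset _ _)⟩)
    · ext y
      simp only [Set.mem_ofPred_eq, sameCell_iff, Finset.filter_inj']
      exact ⟨fun h t ht => ⟨(h.1 ht).symm, (h.2 ht).symm⟩,
        fun h => ⟨fun t ht => (h t ht).1.symm, fun t ht => (h t ht).2.symm⟩⟩
  obtain ⟨f, hf⟩ := hsub
  have hfin := (Finset.finite_toSet (T.powerset ×ˢ T.powerset)).image f
  refine ⟨hfin.subset hf, (Set.ncard_le_ncard hf hfin).trans
    ((Set.ncard_image_le (Finset.finite_toSet _)).trans ?_)⟩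
  rw [Set.ncard_coe_finset, Finset.card_product, Finset.card_powerset, ← mul_pow]
  norm_num

lemma generic_of_planesInGeneralPosition {T : Finset E3} (hT : 3 ≤ T.card)
    (h : PlanesInGeneralPosition (planeOf '' T)) : Generic T := by
  refine Generic.of_triple_of_four hT ?_ fun q => ?_
  · intro a ha b hb c hc hab hac hbc hcross
    obtain ⟨x, ⟨hxa, hxb, hxc⟩, hu⟩ := h.triple _ ⟨a, ha, rfl⟩ _ ⟨b, hb, rfl⟩ _ ⟨c, hc, rfl⟩
      (planeOf_injective.ne hab) (planeOf_injective.ne hac) (planeOf_injective.ne hbc)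
    -- If the projections are collinear with horizontal normal `d`, then `(d 0, d 1, k)` is a
    -- direction common to the three planes, so their common point is not unique.
    obtain ⟨d, hd, hd2, k, hak, hbk, hck⟩ := exists_vertical_plane hcross
    simp only [plane, Set.mem_ofPred_eq, inner_eq, hd2] at hak hbk hck
    have key : ∀ t, t 0 * d 0 + t 1 * d 1 + t 2 * 0 = k → x ∈ planeOf t →
        x + !₂[d 0, d 1, k] ∈ planeOf t := by
      intro t ht hxt
      simp only [planeOf, Set.mem_ofPred_eq, ev] at hxt ⊢
      simp
      linarith
    have heq := hu _ ⟨key a hak hxa, key b hbk hxb, key c hck hxc⟩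
    have h0 := congrArg (fun p : E3 => p 0) heq
    have h1 := congrArg (fun p : E3 => p 1) heq
    simp at h0 h1
    exact hd (e3_ext h0 h1 hd2)
  · have h1 := h.not_four q
    have h2 := encard_setOf_mem_image T (fun H => q ∈ H)
    rw [h2] at h1
    exact_mod_cast h1

lemma Generic.planesInGeneralPosition {T : Finset E3} (hT : Generic T) :
    PlanesInGeneralPosition (planeOf '' T) where
  isPlane := by
    rintro _ ⟨t, _, rfl⟩
    exact isPlane_planeOf t
  not_vertical := by
    rintro _ ⟨t, _, rfl⟩
    exact not_isVertical_planeOf t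
  triple := by
    rintro _ ⟨a, ha, rfl⟩ _ ⟨b, hb, rfl⟩ _ ⟨c, hc, rfl⟩ hab hac hbc
    have hcross := hT.triple a ha b hb c hc (fun h => hab (by rw [h])) (fun h => hac (by rw [h]))
      (fun h => hbc (by rw [h]))
    obtain ⟨q, hqa, hqb, hqc⟩ := exists_ev_eq_zero hcross
    exact ⟨q, ⟨hqa, hqb, hqc⟩, fun p hp => eq_of_ev_eq_zero hcross hp.1 hp.2.1 hp.2.2 hqa hqb hqc⟩
  not_four q := by
    rw [encard_setOf_mem_image T (fun H => q ∈ H)]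
    exact_mod_cast hT.four q

/-! ### The upper bound for the complexity of an intersection of levels -/

/-- Following an edge of the arrangement to an end point. -/
lemma Generic.exists_edge_end {T : Finset E3} (hT : Generic T) (hT3 : 3 ≤ T.card) {x : E3}
    (hx : (T.filter (fun t => ev t x = 0)).card = 2) :
    ∃ q ∈ closure (cellAt T x), (T.filter (fun t => ev t q = 0)).card = 3 ∧
      ∃ h ∈ T.filter (fun t => ev t q = 0), ev h x ≠ 0 ∧
        (∀ t ∈ T, ev t q = 0 → t ≠ h → ev t x = 0) ∧
        ∀ t ∈ T, ev t q ≠ 0 → ev t x ≠ 0 ∧ (0 < ev t x ↔ 0 < ev t q) := by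
  obtain ⟨a, b, hab, hZ⟩ := Finset.card_eq_two.1 hx
  have hmem : ∀ t, (t ∈ T ∧ ev t x = 0) ↔ t = a ∨ t = b := by
    intro t
    rw [← Finset.mem_filter (p := fun t => ev t x = 0), hZ, Finset.mem_insert,
      Finset.mem_singleton]
  obtain ⟨haT, hax⟩ := (hmem a).2 (Or.inl rfl)
  obtain ⟨hbT, hbx⟩ := (hmem b).2 (Or.inr rfl)
  obtain ⟨d, hda, hdb, hd⟩ := exists_common_direction a b
  have hrate : ∀ t ∈ T, ev t x ≠ 0 → rate t d ≠ 0 := by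
    intro t ht htx
    have hta : t ≠ a := fun h => htx (h ▸ hax)
    have htb : t ≠ b := fun h => htx (h ▸ hbx)
    exact hd t (hT.triple a haT b hbT t ht hab hta.symm htb.symm)
  have hne : (T.filter (fun t => ev t x ≠ 0)).Nonempty := by
    rw [Finset.nonempty_iff_ne_empty]
    intro h0
    have := Finset.card_filter_add_card_filter_not (s := T) (fun t => ev t x = 0)
    rw [hx, h0, Finset.card_empty] at this
    omega
  -- Among the planes not through `x`, choose one that the line common to `a` and `b` meets nearest
  -- to `x`; no sign changes before it is reached.
  obtain ⟨h, hh, hmin⟩ := Finset.exists_min_image _ (fun t => |ev t x / rate t d|) hne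
  rw [Finset.mem_filter] at hh
  obtain ⟨hhT, hhx⟩ := hh
  have hrh := hrate h hhT hhx
  set s : ℝ := -(ev h x / rate h d) with hs
  -- moving a fraction `θ` of the way towards the nearest plane
  have hbound : ∀ t ∈ T, ev t x ≠ 0 → |s * rate t d| ≤ |ev t x| := by
    intro t ht htx
    have h1 := hmin t (Finset.mem_filter.2 ⟨ht, htx⟩)
    have h2 := abs_pos.2 (hrate t ht htx)
    rw [abs_div (ev t x), le_div_iff₀ h2] at h1
    rwa [hs, abs_mul, abs_neg]
  have hzero : ∀ t, (t = a ∨ t = b) → rate t d = 0 := by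
    rintro t (rfl | rfl) <;> assumption
  have hmove : ∀ θ : ℝ, ∀ t, ev t (x + (θ * s) • d) = ev t x + θ * (s * rate t d) := by
    intro θ t
    rw [ev_add_smul]
    ring
  have hcell : ∀ θ : ℝ, 0 ≤ θ → θ < 1 → x + (θ * s) • d ∈ cellAt T x := by
    intro θ h0 h1
    refine sameCell_iff.2 fun t ht => ?_
    rw [hmove]
    by_cases htx : ev t x = 0
    · rw [hzero t ((hmem t).1 ⟨ht, htx⟩), htx]
      simp
    · have h2 : |θ * (s * rate t d)| < |ev t x| := by
        rw [abs_mul, abs_of_nonneg h0]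
        calc θ * |s * rate t d| ≤ θ * |ev t x| := mul_le_mul_of_nonneg_left (hbound t ht htx) h0
          _ < 1 * |ev t x| := mul_lt_mul_of_pos_right h1 (abs_pos.2 htx)
          _ = |ev t x| := one_mul _
      rcases lt_or_gt_of_ne htx with h3 | h3
      · rw [abs_of_neg h3, abs_lt] at h2
        exact ⟨⟨fun h => absurd h htx, fun h => by linarith⟩,
          ⟨fun h => by linarith, fun h => by linarith⟩⟩
      · rw [abs_of_pos h3, abs_lt] at h2
        exact ⟨⟨fun h => absurd h htx, fun h => by linarith⟩,
          ⟨fun h => by linarith, fun h => by linarith⟩⟩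
  have hq : ∀ t, ev t (x + s • d) = ev t x + s * rate t d := fun t => ev_add_smul t x d s
  have hqh : ev h (x + s • d) = 0 := by
    rw [hq, hs]
    field_simp
    ring
  have hha : a ≠ h := fun h' => hhx (h' ▸ hax)
  have hhb : b ≠ h := fun h' => hhx (h' ▸ hbx)
  have hsub : ({a, b, h} : Finset E3) ⊆ T.filter (fun t => ev t (x + s • d) = 0) := by
    intro t ht
    simp only [Finset.mem_insert, Finset.mem_singleton] at ht
    rw [Finset.mem_filter]
    rcases ht with rfl | rfl | rfl
    · exact ⟨haT, by rw [hq, hax, hda]; ring⟩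
    · exact ⟨hbT, by rw [hq, hbx, hdb]; ring⟩
    · exact ⟨hhT, hqh⟩
  have hc3 : ({a, b, h} : Finset E3).card = 3 :=
    Finset.card_eq_three.2 ⟨a, b, h, hab, hha, hhb, rfl⟩
  have hZq : ({a, b, h} : Finset E3) = T.filter (fun t => ev t (x + s • d) = 0) :=
    Finset.eq_of_subset_of_card_le hsub (by rw [hc3]; exact hT.four _)
  refine ⟨x + s • d, ?_, by rw [← hZq, hc3], h, Finset.mem_filter.2 ⟨hhT, hqh⟩, hhx, ?_, ?_⟩
  · have hlim : Tendsto (fun θ : ℝ => x + (θ * s) • d) (𝓝[<] 1) (𝓝 (x + s • d)) := by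
      have : Continuous fun θ : ℝ => x + (θ * s) • d := by fun_prop
      simpa using (this.tendsto 1).mono_left nhdsWithin_le_nhds
    refine mem_closure_of_tendsto hlim ?_
    filter_upwards [Ico_mem_nhdsLT (zero_lt_one' ℝ)] with θ hθ
    exact hcell θ hθ.1 hθ.2
  · intro t ht htq hth
    have : t ∈ ({a, b, h} : Finset E3) := by
      rw [hZq]
      exact Finset.mem_filter.2 ⟨ht, htq⟩
    simp only [Finset.mem_insert, Finset.mem_singleton, hth, or_false] at this
    exact ((hmem t).2 this).2
  · intro t ht htq
    have htx : ev t x ≠ 0 := by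
      intro htx
      apply htq
      rw [hq, htx, hzero t ((hmem t).1 ⟨ht, htx⟩)]
      ring
    refine ⟨htx, ?_⟩
    have h2 := hbound t ht htx
    rw [hq] at htq ⊢
    rcases lt_or_gt_of_ne htx with h3 | h3
    · rw [abs_of_neg h3, abs_le] at h2
      exact ⟨fun h => by linarith, fun h => by linarith⟩
    · rw [abs_of_pos h3, abs_le] at h2
      exact ⟨fun _ => lt_of_le_of_ne (by linarith) htq.symm, fun _ => h3⟩

/-- The edge with end point `q` that is contained in all planes at `q` except `h`, and above `h`
if and only if `σ` is true. -/
def edgeAt (T : Finset E3) (q h : E3) (σ : Bool) : Set E3 :=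
  {y | ∀ t ∈ T, (ev t q ≠ 0 → ev t y ≠ 0 ∧ (0 < ev t y ↔ 0 < ev t q)) ∧
    (ev t q = 0 → t ≠ h → ev t y = 0) ∧ (t = h → ev t y ≠ 0 ∧ (0 < ev t y ↔ σ = true))}

lemma cellAt_eq_edgeAt {T : Finset E3} {q h x : E3} {σ : Bool}
    (hx : x ∈ edgeAt T q h σ) : cellAt T x = edgeAt T q h σ := by
  ext y
  rw [cellAt, Set.mem_ofPred_eq, sameCell_iff]
  constructor
  · intro hy t ht
    obtain ⟨h1, h2, h3⟩ := hx t ht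
    obtain ⟨e1, e2⟩ := hy t ht
    exact ⟨fun h => ⟨fun h' => (h1 h).1 (e1.2 h'), e2.symm.trans (h1 h).2⟩,
      fun h h' => e1.1 (h2 h h'), fun h => ⟨fun h' => (h3 h).1 (e1.2 h'), e2.symm.trans (h3 h).2⟩⟩
  · intro hy t ht
    obtain ⟨h1, h2, h3⟩ := hx t ht
    obtain ⟨g1, g2, g3⟩ := hy t ht
    by_cases htq : ev t q = 0
    · by_cases hth : t = h
      · exact ⟨iff_of_false (h3 hth).1 (g3 hth).1, (h3 hth).2.trans (g3 hth).2.symm⟩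
      · have e1 := h2 htq hth
        have e2 := g2 htq hth
        exact ⟨iff_of_true e1 e2, iff_of_false e1.not_gt e2.not_gt⟩
    · exact ⟨iff_of_false (h1 htq).1 (g1 htq).1, (h1 htq).2.trans (g1 htq).2.symm⟩

/-- At most `2 * maxVertices` vertices have one of the two admissible depths. Besides itself, each
accounts for at most six edges, one for each plane left and each side of it: `(1 + 6) * 2 = 14`. -/
lemma complexity_le {R B : Finset E3} (hRB : Disjoint R B) (hT : Generic (R ∪ B))
    (h3 : 3 ≤ (R ∪ B).card) (k k' : ℕ) :
    complexity (planeOf '' (R ∪ B : Finset E3)) (level (planeOf '' R) k ∩ level (planeOf '' B) k') ≤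
      14 * maxVertices (R ∪ B).card := by
  set T := R ∪ B with hTdef
  set X := level (planeOf '' (R : Set E3)) k ∩ level (planeOf '' (B : Set E3)) k' with hX
  have hXc : IsClosed X := isClosed_closure.inter isClosed_closure
  have hsum : ∀ p : E3 → Prop, (T.filter p).card = (R.filter p).card + (B.filter p).card :=
    fun p => ncard_filter_union hRB.symm p
  have hfin := (hT.finite_vertices (k + k' - 3)).union (hT.finite_vertices (k + k' - 2))
  set W : Finset E3 := hfin.toFinset with hW
  have hWmem : ∀ q ∈ X, (T.filter (fun t => ev t q = 0)).card = 3 → q ∈ W := by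
    intro q hq hq3
    rw [hW, Set.Finite.mem_toFinset]
    have h1 := card_le_of_mem_level hq.1
    have h2 := card_le_of_mem_level hq.2
    have h4 := hsum (fun t => ev t q = 0)
    have h5 := hsum (fun t => 0 < ev t q)
    -- The bounds for the two colours add up, with three planes through `q`: the total number of
    -- planes below is at least `k + k' - 3` and at most `k + k' - 2`.
    have : (T.filter (fun t => 0 < ev t q)).card = k + k' - 3 ∨
        (T.filter (fun t => 0 < ev t q)).card = k + k' - 2 := by omega
    exact this.imp (fun h => ⟨hq3, h⟩) (fun h => ⟨hq3, h⟩)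
  have hW3 : ∀ q ∈ W, (T.filter (fun t => ev t q = 0)).card = 3 := by
    intro q hq
    rw [hW, Set.Finite.mem_toFinset] at hq
    exact hq.elim (fun h => h.1) (fun h => h.1)
  have hWcard : W.card ≤ 2 * maxVertices T.card := by
    rw [hW, ← Set.ncard_eq_toFinset_card _ hfin]
    refine (Set.ncard_union_le _ _).trans ?_
    have h1 := hT.ncard_vertices_le_max le_rfl (k + k' - 3)
    have h2 := hT.ncard_vertices_le_max le_rfl (k + k' - 2)
    omega
  -- an edge is determined by an end point, the third plane at it, and the side of that plane
  let K : Finset ((Σ _ : E3, E3) × Bool) :=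
    (W.sigma fun q => T.filter (fun t => ev t q = 0)) ×ˢ Finset.univ
  have hK : K.card = 6 * W.card := by
    rw [Finset.card_product, Finset.card_sigma, Finset.sum_congr rfl hW3]
    simp
    ring
  let edge : ((Σ _ : E3, E3) × Bool) → Set E3 := fun p => edgeAt T p.1.1 p.1.2 p.2
  have hcover : {C | C ∈ cells (planeOf '' (T : Set E3)) ∧ cellDim C ≤ 2 ∧ C ⊆ X} ⊆
      cellAt T '' W ∪ edge '' K := by
    rintro C ⟨hC, -, hCX⟩
    rw [cells_eq_range] at hC
    obtain ⟨x, rfl⟩ := hC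
    have hx := hCX (mem_cellAt_self T x)
    have h1 := card_le_of_mem_level hx.1
    have h2 := card_le_of_mem_level hx.2
    have h4 := hsum (fun t => ev t x = 0)
    have h5 := hT.four x
    by_cases hx3 : (T.filter (fun t => ev t x = 0)).card = 3
    · exact Or.inl ⟨x, hWmem x hx hx3, rfl⟩
    -- There is a plane of each colour through `x`, hence exactly two planes in this case.
    -- Closedness of `X` then keeps the end point of the edge in `X`.
    obtain ⟨q, hq, hq3, h, hh, hhx, hzero, hsign⟩ := hT.exists_edge_end h3 (x := x) (by omega)
    have hqW := hWmem q (closure_minimal hCX hXc hq) hq3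
    refine Or.inr ⟨(⟨q, h⟩, decide (0 < ev h x)), ?_, ?_⟩
    · exact Finset.mem_coe.2 (Finset.mem_product.2 ⟨Finset.mem_sigma.2 ⟨hqW, hh⟩,
        Finset.mem_univ _⟩)
    · refine (cellAt_eq_edgeAt fun t ht => ?_).symm
      refine ⟨hsign t ht, hzero t ht, ?_⟩
      rintro rfl
      exact ⟨hhx, by simp⟩
  have hfin' : (cellAt T '' W ∪ edge '' K).Finite :=
    ((Finset.finite_toSet _).image _).union ((Finset.finite_toSet _).image _)
  refine (Set.ncard_le_ncard hcover hfin').trans ((Set.ncard_union_le _ _).trans ?_)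
  have h1 := Set.ncard_image_le (f := cellAt T) (Finset.finite_toSet W)
  have h2 := Set.ncard_image_le (f := edge) (Finset.finite_toSet K)
  rw [Set.ncard_coe_finset] at h1 h2
  omega

/-- The bound `4 ^ n` serves the existence of the maximum for every `n`; the other one needs three
planes to obtain `Generic`. -/
lemma intersectionComplexities_le {n m : ℕ} (hm : m ∈ intersectionComplexities n) :
    m ≤ 4 ^ n ∧ (3 ≤ n → m ≤ 14 * maxVertices n) := by
  obtain ⟨R, B, hRB, hfin, hn, hG, k, k', rfl⟩ := hm
  obtain ⟨R, rfl⟩ := exists_finset_eq_image (hfin.subset Set.subset_union_left)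
    (fun H hH => hG.isPlane H (Or.inl hH)) (fun H hH => hG.not_vertical H (Or.inl hH))
  obtain ⟨B, rfl⟩ := exists_finset_eq_image (hfin.subset Set.subset_union_right)
    (fun H hH => hG.isPlane H (Or.inr hH)) (fun H hH => hG.not_vertical H (Or.inr hH))
  rw [← Set.image_union, ← Finset.coe_union] at *
  rw [Set.ncard_image_of_injective _ planeOf_injective, Set.ncard_coe_finset] at hn
  have hRB' : Disjoint R B := by
    rw [Set.disjoint_image_iff planeOf_injective] at hRB
    exact Finset.disjoint_coe.1 hRB
  constructor
  · obtain ⟨h1, h2⟩ := finite_cells_and_ncard_le (R ∪ B)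
    rw [hn] at h2
    exact (Set.ncard_le_ncard (fun C hC => hC.1) h1).trans h2
  · intro h3
    rw [← hn] at h3 ⊢
    exact complexity_le hRB' (generic_of_planesInGeneralPosition h3 hG) h3 k k'

lemma isGreatest_intersectionComplexities (n : ℕ) :
    IsGreatest (intersectionComplexities n) (ℓ n) := by
  have hbdd : BddAbove (intersectionComplexities n) :=
    ⟨4 ^ n, fun _ h => (intersectionComplexities_le h).1⟩
  refine ⟨Nat.sSup_mem ?_ hbdd, fun _ h => le_csSup hbdd h⟩
  obtain ⟨T, hT, rfl⟩ := exists_generic n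
  refine ⟨_, planeOf '' T, ∅, Set.disjoint_empty _, ?_, ?_, ?_, 0, 0, rfl⟩
  · rw [Set.union_empty]
    exact T.finite_toSet.image _
  · rw [Set.union_empty, Set.ncard_image_of_injective _ planeOf_injective, Set.ncard_coe_finset]
  · rw [Set.union_empty]
    exact hT.planesInGeneralPosition

lemma ℓ_le {n : ℕ} (hn : 3 ≤ n) : ℓ n ≤ 14 * maxVertices n :=
  (intersectionComplexities_le (isGreatest_intersectionComplexities n).1).2 hn

/-! ### The lower bound: doubling the planes -/

lemma mem_level_of_card_eq_one {T : Finset E3} {x : E3}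
    (h : (T.filter (fun t => ev t x = 0)).card = 1) :
    x ∈ level (planeOf '' T) ((T.filter (fun t => 0 < ev t x)).card + 1) := by
  rw [level_eq]
  exact subset_closure ⟨h, rfl⟩

/-- Slide along `a` to the lower side of `b`: only `a` still passes through the point, and the set
of planes below is unchanged. -/
lemma Generic.mem_level_of_card_eq_two {T : Finset E3} (hT : Generic T) {x : E3}
    (h : (T.filter (fun t => ev t x = 0)).card = 2) :
    x ∈ level (planeOf '' T) ((T.filter (fun t => 0 < ev t x)).card + 1) := by
  obtain ⟨a, b, hab, hZ⟩ := Finset.card_eq_two.1 h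
  have hmem : ∀ t, (t ∈ T ∧ ev t x = 0) ↔ t = a ∨ t = b := by
    intro t
    rw [← Finset.mem_filter (p := fun t => ev t x = 0), hZ, Finset.mem_insert,
      Finset.mem_singleton]
  obtain ⟨haT, hax⟩ := (hmem a).2 (Or.inl rfl)
  obtain ⟨hbT, hbx⟩ := (hmem b).2 (Or.inr rfl)
  obtain ⟨d, hda, hdb⟩ := exists_direction (hT.pair a haT b hbT hab)
  rw [level_eq]
  have hlim : Tendsto (fun s : ℝ => x + s • d) (𝓝[>] 0) (𝓝 x) := by
    have : Continuous fun s : ℝ => x + s • d := by fun_prop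
    simpa using (this.tendsto 0).mono_left nhdsWithin_le_nhds
  refine mem_closure_of_tendsto hlim ?_
  filter_upwards [hlim.eventually (eventually_sign T x), self_mem_nhdsWithin] with s hs hs0
  have hs0 : 0 < s := hs0
  have ha : ev a (x + s • d) = 0 := by rw [ev_add_smul, hax, hda]; ring
  have hb : ev b (x + s • d) < 0 := by
    rw [ev_add_smul, hbx, hdb]
    linarith
  constructor
  · rw [Finset.card_eq_one]
    refine ⟨a, ?_⟩
    ext t
    rw [Finset.mem_filter, Finset.mem_singleton]
    constructor
    · rintro ⟨ht, ht0⟩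
      have htx : ev t x = 0 := by
        rcases lt_trichotomy (ev t x) 0 with h | h | h
        · exact absurd ht0 ((hs t ht).2 h).ne
        · exact h
        · exact absurd ht0 ((hs t ht).1 h).ne'
      refine ((hmem t).1 ⟨ht, htx⟩).resolve_right ?_
      rintro rfl
      exact hb.ne ht0
    · rintro rfl
      exact ⟨haT, ha⟩
  · congr 2
    refine Finset.filter_congr fun t ht => ?_
    rcases lt_trichotomy (ev t x) 0 with h | h | h
    · exact iff_of_false ((hs t ht).2 h).not_gt h.not_gt
    · refine iff_of_false ?_ h.not_gt
      rcases (hmem t).1 ⟨ht, h⟩ with rfl | rfl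
      · exact ha.not_gt
      · exact hb.not_gt
    · exact iff_of_true ((hs t ht).1 h) h

lemma Generic.cellAt_eq_singleton {T : Finset E3} (hT : Generic T) {x : E3}
    (hx : (T.filter (fun t => ev t x = 0)).card = 3) : cellAt T x = {x} := by
  refine Set.eq_singleton_iff_unique_mem.2 ⟨mem_cellAt_self T x, fun y hy => ?_⟩
  refine (hT.eq_of_filter_eq hx fun t ht => ?_).symm
  rw [Finset.mem_filter] at ht ⊢
  exact ⟨ht.1, ((sameCell_iff.1 hy t ht.1).1).1 ht.2⟩

/-- A vertex moves continuously with one of its planes. -/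
lemma Generic.eventually_exists_moved_vertex {T : Finset E3} (hT : Generic T) {q a b c : E3}
    (hab : a ≠ b) (hac : a ≠ c) (hbc : b ≠ c)
    (hq : T.filter (fun t => ev t q = 0) = {a, b, c}) :
    ∀ᶠ δ in 𝓝[>] (0 : ℝ), ∀ f : E3 → E3, (∀ t ∈ T, dist (f t) t < δ) →
      ∃ p, ev a p = 0 ∧ ev b p = 0 ∧ ev (f c) p = 0 ∧
        ∀ t ∈ T, (0 < ev t q → 0 < ev t p ∧ 0 < ev (f t) p) ∧
          (ev t q < 0 → ev t p < 0 ∧ ev (f t) p < 0) := by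
  have hmem : ∀ t ∈ ({a, b, c} : Finset E3), t ∈ T ∧ ev t q = 0 := fun t ht => by
    rw [← hq] at ht
    exact Finset.mem_filter.1 ht
  obtain ⟨haT, haq⟩ := hmem a (by simp)
  obtain ⟨hbT, hbq⟩ := hmem b (by simp)
  obtain ⟨hcT, hcq⟩ := hmem c (by simp)
  obtain ⟨d, hda, hdb, hdc⟩ := exists_common_direction a b
  have hdc := hdc c (hT.triple a haT b hbT c hcT hab hac hbc)
  have hrate : Continuous fun t : E3 => rate t d := by
    unfold rate
    fun_prop
  -- When `rate t d ≠ 0`, `g t` is where the line common to `a` and `b` meets the plane `t`.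
  -- Transversality to `c` makes `g` continuous at `c`.
  obtain ⟨g, hg⟩ : ∃ g : E3 → E3, ∀ t, g t = q + (-(ev t q) / rate t d) • d := ⟨_, fun _ => rfl⟩
  have hgc : Tendsto g (𝓝 c) (𝓝 q) := by
    have h1 : ContinuousAt g c := by
      rw [funext hg]
      exact continuousAt_const.add
        ((((continuous_ev_left q).neg.continuousAt).div hrate.continuousAt hdc).smul
          continuousAt_const)
    have h2 : g c = q := by simp [hg, hcq]
    rw [ContinuousAt, h2] at h1
    exact h1
  have hpt : ∀ t ∈ T, ∀ᶠ p : E3 × E3 in 𝓝 (t, c), rate p.2 d ≠ 0 ∧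
      (0 < ev t q → 0 < ev t (g p.2) ∧ 0 < ev p.1 (g p.2)) ∧
      (ev t q < 0 → ev t (g p.2) < 0 ∧ ev p.1 (g p.2) < 0) := by
    intro t _
    have l1 : Tendsto (fun p : E3 × E3 => g p.2) (𝓝 (t, c)) (𝓝 q) :=
      hgc.comp (continuous_snd.tendsto (t, c))
    have l2 : Tendsto (fun p : E3 × E3 => ev t (g p.2)) (𝓝 (t, c)) (𝓝 (ev t q)) :=
      ((continuous_ev_right t).tendsto q).comp l1
    have l3 : Tendsto (fun p : E3 × E3 => ev p.1 (g p.2)) (𝓝 (t, c)) (𝓝 (ev t q)) :=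
      Tendsto.comp (g := fun p : E3 × E3 => ev p.1 p.2) (f := fun p : E3 × E3 => (p.1, g p.2))
        (continuous_ev.tendsto (t, q)) (Tendsto.prodMk_nhds (continuous_fst.tendsto (t, c)) l1)
    have l4 : Tendsto (fun p : E3 × E3 => rate p.2 d) (𝓝 (t, c)) (𝓝 (rate c d)) :=
      (hrate.tendsto c).comp (continuous_snd.tendsto (t, c))
    refine (l4.eventually_ne hdc).and (Filter.Eventually.and ?_ ?_)
    · by_cases h : 0 < ev t q
      · filter_upwards [l2.eventually (lt_mem_nhds h), l3.eventually (lt_mem_nhds h)] with p h1 h2 _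
        exact ⟨h1, h2⟩
      · exact Eventually.of_forall fun _ h' => absurd h' h
    · by_cases h : ev t q < 0
      · filter_upwards [l2.eventually (gt_mem_nhds h), l3.eventually (gt_mem_nhds h)] with p h1 h2 _
        exact ⟨h1, h2⟩
      · exact Eventually.of_forall fun _ h' => absurd h' h
  -- The estimate concerns arbitrary pairs near `(t, c)`, so a single `δ` works for every
  -- perturbation `f`.
  have hδ : ∀ᶠ δ in 𝓝[>] (0 : ℝ), ∀ t ∈ T, ∀ p : E3 × E3, dist p (t, c) < δ → rate p.2 d ≠ 0 ∧
      (0 < ev t q → 0 < ev t (g p.2) ∧ 0 < ev p.1 (g p.2)) ∧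
      (ev t q < 0 → ev t (g p.2) < 0 ∧ ev p.1 (g p.2) < 0) := by
    rw [eventually_all_finset]
    intro t ht
    obtain ⟨ε, hε, h⟩ := Metric.eventually_nhds_iff.1 (hpt t ht)
    filter_upwards [Ioo_mem_nhdsGT hε] with δ hδ p hp
    exact h (hp.trans hδ.2)
  filter_upwards [hδ] with δ hδ f hf
  have hfp : ∀ t ∈ T, dist (f t, f c) (t, c) < δ := fun t ht => by
    rw [Prod.dist_eq]
    exact max_lt (hf t ht) (hf c hcT)
  refine ⟨g (f c), ?_, ?_, ?_, fun t ht => (hδ t ht _ (hfp t ht)).2⟩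
  · simp only [hg, ev_add_smul, haq, hda]
    ring
  · simp only [hg, ev_add_smul, hbq, hdb]
    ring
  · have := (hδ c hcT _ (hfp c hcT)).1
    simp only [hg, ev_add_smul]
    field_simp
    ring

/-- A generic set has a disjoint, arbitrarily close copy such that the union is generic. -/
lemma Generic.exists_close_copy {T : Finset E3} (hT : Generic T) {δ : ℝ} (hδ : 0 < δ) :
    ∃ f : E3 → E3, (∀ t ∈ T, dist (f t) t < δ) ∧ Set.InjOn f T ∧ Disjoint (T.image f) T ∧
      Generic (T ∪ T.image f) := by
  -- The induction copies a subset `S` only, but keeps the copies generic together with all of `T`.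
  suffices h : ∀ S : Finset E3, ∃ f : E3 → E3, (∀ t ∈ S, dist (f t) t < δ) ∧ Set.InjOn f S ∧
      Disjoint (S.image f) T ∧ Generic (T ∪ S.image f) from h T
  intro S
  induction S using Finset.induction_on with
  | empty => exact ⟨id, by simp, by simp, by simp, by simpa using hT⟩
  | insert s S hs ih =>
    obtain ⟨f, hf, hinj, hdis, hG⟩ := ih
    obtain ⟨s', hs', hs'T, hG'⟩ := hG.exists_insert (Metric.isOpen_ball (x := s) (ε := δ))
      ⟨s, Metric.mem_ball_self hδ⟩
    rw [Finset.mem_union, not_or] at hs'T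
    have hne : ∀ t ∈ S, t ≠ s := fun t ht h => hs (h ▸ ht)
    have heq : ∀ t ∈ S, Function.update f s s' t = f t := fun t ht =>
      Function.update_of_ne (hne t ht) _ _
    have himage : (insert s S).image (Function.update f s s') = insert s' (S.image f) := by
      rw [Finset.image_insert, Function.update_self]
      congr 1
      exact Finset.image_congr heq
    refine ⟨Function.update f s s', ?_, ?_, ?_, ?_⟩
    · intro t ht
      rcases Finset.mem_insert.1 ht with rfl | ht
      · rw [Function.update_self]
        exact hs'
      · rw [heq t ht]
        exact hf t ht
    · rw [Finset.coe_insert, Set.injOn_insert (by simpa using hs)]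
      refine ⟨fun x hx y hy h => ?_, ?_⟩
      · rw [heq x hx, heq y hy] at h
        exact hinj hx hy h
      · rintro ⟨t, ht, h⟩
        rw [heq t ht, Function.update_self] at h
        exact hs'T.2 (Finset.mem_image.2 ⟨t, ht, h⟩)
    · rw [himage, Finset.disjoint_insert_left]
      exact ⟨hs'T.1, hdis⟩
    · rw [himage, Finset.union_insert]
      exact hG'

/-- With `B` a close copy of `T` plus padding, each vertex moves to a vertex on two planes of `T`
and one of `B`, so it lies on a level of each. These levels vary little because strict signs at the
old vertex persist. -/
lemma Generic.ncard_vertices_le_ℓ {T : Finset E3} (hT : Generic T) {n : ℕ} (hn : 2 * T.card ≤ n)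
    (m : ℕ) : (vertices T m).ncard ≤ 6 * ℓ n := by
  have hV := hT.finite_vertices m
  have htriple : ∀ q ∈ vertices T m, ∃ a b c, a ≠ b ∧ a ≠ c ∧ b ≠ c ∧
      T.filter (fun t => ev t q = 0) = {a, b, c} := fun q hq => Finset.card_eq_three.1 hq.1
  choose! a b c hab hac hbc habc using htriple
  have hev : ∀ᶠ δ in 𝓝[>] (0 : ℝ), ∀ q ∈ vertices T m, ∀ f : E3 → E3,
      (∀ t ∈ T, dist (f t) t < δ) → ∃ p, ev (a q) p = 0 ∧ ev (b q) p = 0 ∧ ev (f (c q)) p = 0 ∧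
        ∀ t ∈ T, (0 < ev t q → 0 < ev t p ∧ 0 < ev (f t) p) ∧
          (ev t q < 0 → ev t p < 0 ∧ ev (f t) p < 0) := by
    rw [eventually_all_finite hV]
    exact fun q hq => hT.eventually_exists_moved_vertex (hab q hq) (hac q hq) (hbc q hq) (habc q hq)
  obtain ⟨δ, hδ, hδ0⟩ := (hev.and self_mem_nhdsWithin).exists
  obtain ⟨f, hf, hinj, hdis, hG⟩ := hT.exists_close_copy hδ0
  have hp := fun q hq => hδ q hq f hf
  choose! p hpa hpb hpc hpt using hp
  -- The padding lies above all moved vertices, so it does not change the number of planes below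
  -- them.
  obtain ⟨X, hX, hXc, hXG, hXneg⟩ := hG.exists_extension (hV.image p) (-1) (by simp)
    (n - 2 * T.card)
  rw [Finset.disjoint_union_right] at hX
  set B := T.image f ∪ X with hB
  have hTB : T ∪ T.image f ∪ X = T ∪ B := Finset.union_assoc _ _ _
  rw [hTB] at hXG
  have hdisj : Disjoint T B := by
    rw [hB, Finset.disjoint_union_right]
    exact ⟨hdis.symm, hX.1.symm⟩
  have hBcard : B.card = T.card + (n - 2 * T.card) := by
    rw [hB, Finset.card_union_of_disjoint hX.2.symm, Finset.card_image_of_injOn hinj, hXc]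
  have hcard : (T ∪ B).card = n := by
    rw [Finset.card_union_of_disjoint hdisj, hBcard]
    omega
  have hXneg' : ∀ t ∈ X, ∀ q ∈ vertices T m, ev t (p q) < 0 := by
    intro t ht q hq
    have := hXneg t ht (p q) ⟨q, hq, rfl⟩
    linarith
  have hmem : ∀ q ∈ vertices T m, ∀ t, (t ∈ T ∧ ev t q = 0) ↔ t = a q ∨ t = b q ∨ t = c q := by
    intro q hq t
    rw [← Finset.mem_filter (p := fun t => ev t q = 0), habc q hq]
    simp
  -- the planes through and below the moved vertices
  have hzero : ∀ q ∈ vertices T m, T.filter (fun t => ev t (p q) = 0) = {a q, b q} ∧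
      B.filter (fun t => ev t (p q) = 0) = {f (c q)} := by
    intro q hq
    have haT := ((hmem q hq (a q)).2 (by simp)).1
    have hbT := ((hmem q hq (b q)).2 (by simp)).1
    have hcT := ((hmem q hq (c q)).2 (by simp)).1
    have s1 : ({a q, b q} : Finset E3) ⊆ T.filter (fun t => ev t (p q) = 0) := by
      intro t ht
      rw [Finset.mem_insert, Finset.mem_singleton] at ht
      rcases ht with rfl | rfl
      · exact Finset.mem_filter.2 ⟨haT, hpa q hq⟩
      · exact Finset.mem_filter.2 ⟨hbT, hpb q hq⟩
    have s2 : ({f (c q)} : Finset E3) ⊆ B.filter (fun t => ev t (p q) = 0) := by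
      rw [Finset.singleton_subset_iff]
      exact Finset.mem_filter.2 ⟨Finset.mem_union_left _ (Finset.mem_image_of_mem f hcT), hpc q hq⟩
    have h3 := hXG.four (p q)
    rw [ncard_filter_union hdisj.symm] at h3
    have c1 := Finset.card_le_card s1
    have c2 := Finset.card_le_card s2
    rw [Finset.card_pair (hab q hq)] at c1
    rw [Finset.card_singleton] at c2
    refine ⟨(Finset.eq_of_subset_of_card_le s1 ?_).symm, (Finset.eq_of_subset_of_card_le s2 ?_).symm⟩
    · rw [Finset.card_pair (hab q hq)]
      omega
    · rw [Finset.card_singleton]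
      omega
  let k : E3 → ℕ := fun q => (T.filter (fun t => 0 < ev t (p q))).card + 1
  let k' : E3 → ℕ := fun q => (B.filter (fun t => 0 < ev t (p q))).card + 1
  -- In `T`, only `c q` is undetermined: `a q` and `b q` pass through `p q`.
  have hk : ∀ q ∈ vertices T m, m + 1 ≤ k q ∧ k q ≤ m + 2 := by
    intro q hq
    have s1 : T.filter (fun t => 0 < ev t q) ⊆ T.filter (fun t => 0 < ev t (p q)) := by
      intro t ht
      rw [Finset.mem_filter] at ht ⊢
      exact ⟨ht.1, ((hpt q hq t ht.1).1 ht.2).1⟩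
    have s2 : T.filter (fun t => 0 < ev t (p q)) ⊆
        insert (c q) (T.filter (fun t => 0 < ev t q)) := by
      intro t ht
      rw [Finset.mem_filter] at ht
      rw [Finset.mem_insert, Finset.mem_filter]
      rcases lt_trichotomy (ev t q) 0 with h | h | h
      · exact absurd ht.2 ((hpt q hq t ht.1).2 h).1.not_gt
      · rcases (hmem q hq t).1 ⟨ht.1, h⟩ with rfl | rfl | rfl
        · exact absurd ht.2 (hpa q hq).not_gt
        · exact absurd ht.2 (hpb q hq).not_gt
        · exact Or.inl rfl
      · exact Or.inr ⟨ht.1, h⟩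
    have c1 := Finset.card_le_card s1
    have c2 := (Finset.card_le_card s2).trans (Finset.card_insert_le _ _)
    rw [hq.2] at c1 c2
    simp only [k]
    omega
  -- In `B`, the copies of `a q` and `b q` are undetermined, while that of `c q` passes through `p
  -- q`.
  have hk' : ∀ q ∈ vertices T m, m + 1 ≤ k' q ∧ k' q ≤ m + 3 := by
    intro q hq
    have hBf : (B.filter (fun t => 0 < ev t (p q))).card =
        (T.filter (fun t => 0 < ev (f t) (p q))).card := by
      rw [hB, ncard_filter_union hX.2, Finset.filter_image, Finset.card_image_of_injOn
        (hinj.mono (Finset.coe_subset.2 (Finset.filter_subset _ _)))]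
      rw [Finset.filter_false_of_mem (s := X) fun t ht => (hXneg' t ht q hq).not_gt]
      rfl
    have s1 : T.filter (fun t => 0 < ev t q) ⊆ T.filter (fun t => 0 < ev (f t) (p q)) := by
      intro t ht
      rw [Finset.mem_filter] at ht ⊢
      exact ⟨ht.1, ((hpt q hq t ht.1).1 ht.2).2⟩
    have s2 : T.filter (fun t => 0 < ev (f t) (p q)) ⊆
        insert (a q) (insert (b q) (T.filter (fun t => 0 < ev t q))) := by
      intro t ht
      rw [Finset.mem_filter] at ht
      rw [Finset.mem_insert, Finset.mem_insert, Finset.mem_filter]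
      rcases lt_trichotomy (ev t q) 0 with h | h | h
      · exact absurd ht.2 ((hpt q hq t ht.1).2 h).2.not_gt
      · rcases (hmem q hq t).1 ⟨ht.1, h⟩ with rfl | rfl | rfl
        · exact Or.inl rfl
        · exact Or.inr (Or.inl rfl)
        · exact absurd ht.2 (hpc q hq).not_gt
      · exact Or.inr (Or.inr ⟨ht.1, h⟩)
    have c1 := Finset.card_le_card s1
    have c2 := ((Finset.card_le_card s2).trans (Finset.card_insert_le _ _)).trans
      (Nat.add_le_add_right (Finset.card_insert_le _ _) 1)
    rw [hq.2] at c1 c2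
    simp only [k', hBf]
    omega
  have hlevel : ∀ q ∈ vertices T m,
      p q ∈ level (planeOf '' (T : Set E3)) (k q) ∩ level (planeOf '' (B : Set E3)) (k' q) := by
    intro q hq
    obtain ⟨h1, h2⟩ := hzero q hq
    exact ⟨hT.mem_level_of_card_eq_two (by rw [h1, Finset.card_pair (hab q hq)]),
      mem_level_of_card_eq_one (by rw [h2, Finset.card_singleton])⟩
  -- The planes through `p q`, together with injectivity of `f` on `T`, recover the three planes
  -- through `q`.
  have hpinj : Set.InjOn p (vertices T m) := by
    intro q hq r hr hqr
    refine hT.eq_of_filter_eq hq.1 ?_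
    obtain ⟨h1, h2⟩ := hzero q hq
    obtain ⟨h3, h4⟩ := hzero r hr
    rw [hqr, h3] at h1
    rw [hqr, h4, Finset.singleton_inj] at h2
    have hc := hinj ((hmem r hr (c r)).2 (by simp)).1 ((hmem q hq (c q)).2 (by simp)).1 h2
    intro t ht
    rw [habc q hq] at ht
    rw [habc r hr]
    have : t ∈ ({a r, b r} : Finset E3) ∨ t = c r := by
      rw [h1, hc]
      simpa [or_assoc] using ht
    simpa [or_assoc] using this
  have hfiber : ∀ i j : ℕ, ({q ∈ hV.toFinset | (k q, k' q) = (i, j)}).card ≤ ℓ n := by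
    intro i j
    have hmemℓ : complexity (planeOf '' (T ∪ B : Finset E3))
        (level (planeOf '' (T : Set E3)) i ∩ level (planeOf '' (B : Set E3)) j) ∈
        intersectionComplexities n := by
      refine ⟨planeOf '' T, planeOf '' B, ?_, ?_, ?_, ?_, i, j, ?_⟩
      · exact (Set.disjoint_image_iff planeOf_injective).2 (Finset.disjoint_coe.2 hdisj)
      all_goals rw [← Set.image_union, ← Finset.coe_union]
      · exact (Finset.finite_toSet _).image _
      · rw [Set.ncard_image_of_injective _ planeOf_injective, Set.ncard_coe_finset, hcard]
      · exact hXG.planesInGeneralPosition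
    refine le_trans ?_ ((isGreatest_intersectionComplexities n).2 hmemℓ)
    rw [← Set.ncard_coe_finset, complexity]
    refine Set.ncard_le_ncard_of_injOn (fun q => {p q}) ?_ ?_
      ((finite_cells_and_ncard_le (T ∪ B)).1.subset fun C hC => hC.1)
    · intro q hq
      rw [Finset.mem_coe, Finset.mem_filter, Set.Finite.mem_toFinset, Prod.mk.injEq] at hq
      obtain ⟨hqV, rfl, rfl⟩ := hq
      obtain ⟨h1, h2⟩ := hzero q hqV
      have h3 : ((T ∪ B).filter (fun t => ev t (p q) = 0)).card = 3 := by
        rw [ncard_filter_union hdisj.symm, h1, h2, Finset.card_pair (hab q hqV),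
          Finset.card_singleton]
      refine ⟨?_, ?_, Set.singleton_subset_iff.2 (hlevel q hqV)⟩
      · rw [cells_eq_range, ← hXG.cellAt_eq_singleton h3]
        exact ⟨p q, rfl⟩
      · change Module.finrank ℝ (vectorSpan ℝ {p q}) ≤ 2
        rw [vectorSpan_singleton, finrank_bot]
        exact Nat.zero_le _
    · intro q hq r hr hqr
      rw [Finset.mem_coe, Finset.mem_filter, Set.Finite.mem_toFinset] at hq hr
      exact hpinj hq.1 hr.1 (Set.singleton_injective hqr)
  rw [Set.ncard_eq_toFinset_card _ hV]
  have himage : hV.toFinset.image (fun q => (k q, k' q)) ⊆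
      Finset.Icc (m + 1) (m + 2) ×ˢ Finset.Icc (m + 1) (m + 3) := by
    intro x hx
    obtain ⟨q, hq, rfl⟩ := Finset.mem_image.1 hx
    rw [Set.Finite.mem_toFinset] at hq
    exact Finset.mem_product.2 ⟨Finset.mem_Icc.2 (hk q hq), Finset.mem_Icc.2 (hk' q hq)⟩
  have h6 := Finset.card_le_card himage
  rw [Finset.card_product, Nat.card_Icc, Nat.card_Icc,
    show m + 2 + 1 - (m + 1) = 2 by omega, show m + 3 + 1 - (m + 1) = 3 by omega] at h6
  -- Pigeonhole over the `2 * 3` possible pairs of levels.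
  calc hV.toFinset.card ≤ ℓ n * (hV.toFinset.image (fun q => (k q, k' q))).card :=
        Finset.card_le_mul_card_image _ _ fun x _ => hfiber x.1 x.2
    _ ≤ ℓ n * 6 := Nat.mul_le_mul_left _ h6
    _ = 6 * ℓ n := mul_comm _ _

lemma maxVertices_half_le_ℓ (n : ℕ) : maxVertices (n / 2) ≤ 6 * ℓ n :=
  maxVertices_le fun _ m hT hTn => hT.ncard_vertices_le_ℓ (by omega) m

/-! ### Combining the inequalities. -/

/-- This absorbs the summand `1` of `maxVertices_le_half` into the constant. -/
lemma one_le_maxVertices {N : ℕ} (hN : 3 ≤ N) : 1 ≤ maxVertices N := by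
  obtain ⟨T, hT, h3⟩ := exists_generic 3
  obtain ⟨a, b, c, hab, hac, hbc, rfl⟩ := Finset.card_eq_three.1 h3
  obtain ⟨q, ha, hb, hc⟩ := exists_ev_eq_zero
    (hT.triple a (by simp) b (by simp) c (by simp) hab hac hbc)
  have hall : ∀ t ∈ ({a, b, c} : Finset E3), ev t q = 0 := by
    intro t ht
    simp only [Finset.mem_insert, Finset.mem_singleton] at ht
    rcases ht with rfl | rfl | rfl <;> assumption
  have hq : q ∈ vertices {a, b, c} 0 := by
    refine ⟨?_, ?_⟩
    · rw [Finset.filter_true_of_mem hall, h3]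
    · rw [Finset.filter_false_of_mem fun t ht => (hall t ht).not_gt, Finset.card_empty]
  exact ((Set.ncard_pos (hT.finite_vertices 0)).2 ⟨q, hq⟩).trans_le
    (hT.ncard_vertices_le_max (by omega) 0)

lemma maxVertices_le_const_mul_half {n : ℕ} (hn : 200 ≤ n) :
    maxVertices n ≤ 7 ^ 40 * 2 * maxVertices (n / 2) := by
  have h1 := maxVertices_le_half hn
  have h2 := one_le_maxVertices (N := n / 2) (by omega)
  rw [mul_assoc]
  exact h1.trans (Nat.mul_le_mul_left _ (by omega))

end PlaneLevels

end

/-- For every `n` the two maxima exist, and `ℓ(n) = Θ(h₃(n))`. -/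
theorem mainTheorem5 :
    (∀ n : ℕ, IsGreatest (PlaneLevels.intersectionComplexities n) (PlaneLevels.ℓ n)) ∧
    (∀ n : ℕ, IsGreatest (PlaneLevels.halvingCounts n) (PlaneLevels.h₃ n)) ∧
    (fun n : ℕ => (PlaneLevels.ℓ n : ℝ)) =Θ[atTop] (fun n : ℕ => (PlaneLevels.h₃ n : ℝ)) := by
  refine ⟨PlaneLevels.isGreatest_intersectionComplexities, PlaneLevels.isGreatest_halvingCounts,
    ?_, ?_⟩
  · refine IsBigO.of_bound ((14 * (7 ^ 40 * 2) : ℕ) : ℝ) ?_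
    filter_upwards [eventually_ge_atTop 200] with n hn
    rw [Real.norm_natCast, Real.norm_natCast]
    have h : PlaneLevels.ℓ n ≤ 14 * (7 ^ 40 * 2) * PlaneLevels.h₃ n :=
      calc PlaneLevels.ℓ n ≤ 14 * PlaneLevels.maxVertices n := PlaneLevels.ℓ_le (by omega)
        _ ≤ 14 * (7 ^ 40 * 2 * PlaneLevels.maxVertices (n / 2)) :=
          Nat.mul_le_mul_left _ (PlaneLevels.maxVertices_le_const_mul_half hn)
        _ ≤ 14 * (7 ^ 40 * 2 * PlaneLevels.h₃ n) :=
          Nat.mul_le_mul_left _ (Nat.mul_le_mul_left _ (PlaneLevels.maxVertices_half_le_h₃ n))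
        _ = _ := by ring
    exact_mod_cast h
  · refine IsBigO.of_bound ((2 * (7 ^ 40 * 2) * 6 : ℕ) : ℝ) ?_
    filter_upwards [eventually_ge_atTop 200] with n hn
    rw [Real.norm_natCast, Real.norm_natCast]
    have h : PlaneLevels.h₃ n ≤ 2 * (7 ^ 40 * 2) * 6 * PlaneLevels.ℓ n :=
      calc PlaneLevels.h₃ n ≤ 2 * PlaneLevels.maxVertices n := PlaneLevels.h₃_le n
        _ ≤ 2 * (7 ^ 40 * 2 * PlaneLevels.maxVertices (n / 2)) :=
          Nat.mul_le_mul_left _ (PlaneLevels.maxVertices_le_const_mul_half hn)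
        _ ≤ 2 * (7 ^ 40 * 2 * (6 * PlaneLevels.ℓ n)) :=
          Nat.mul_le_mul_left _ (Nat.mul_le_mul_left _ (PlaneLevels.maxVertices_half_le_ℓ n))
        _ = _ := by ring
    exact_mod_cast h
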